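/- Let $M$ be a smooth Riemannian manifold of dimension $n$ and let $\phi : M \to \mathbb{S}^{2n+1}\subset\mathbb{C}^{n+1}$ be a Legendrian isometric immersion into the unit sphere, i.e. a smooth immersion which induces the given metric of $M$ and satisfies $\langle \phi_*v, J\phi\rangle = 0$ for all tangent vectors $v$ of $M$, where $\langle\,,\rangle$ is the Euclidean metric and $J$ the complex structure of $\mathbb{C}^{n+1}$. Let $H$ be the mean curvature vector of $\phi$ in $\mathbb{S}^{2n+1}$. The immersion $\phi$ is called C-minimal if $\operatorname{div} JH = 0$, where $JH$ is tangent to $\phi$ and is regarded as a vector field on $M$. Then: 1. If $M$ is oriented, let $\beta : M \to \mathbb{R}/2\pi\mathbb{Z}$ be the Legendrian angle of $\phi$, i.e. the well-defined map with $e^{i\beta(p)} = \det_{\mathbb{C}}(\phi(p), \phi_*e_1,\dots,\phi_*e_n)$ for every oriented orthonormal basis $e_1,\dots,e_n$ of $T_pM$. Then $\phi$ is C-minimal if and only if $\beta$ is a harmonic map. 2. Let $\Pi : \mathbb{S}^{2n+1}\to\mathbb{C}\mathbb{P}^n$, $\Pi(z) = [z]$, be the Hopf fibration onto the complex projective space with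 the Fubini–Study metric of holomorphic sectional curvature $4$. Then $\Phi = \Pi\circ\phi : M \to \mathbb{C}\mathbb{P}^n$ is a Lagrangian immersion which induces the same metric on $M$, and $\phi$ is C-minimal if and only if $\Phi$ is H-minimal, i.e. $\operatorname{div} JH_\Phi = 0$, where $H_\Phi$ is the mean curvature vector of $\Phi$, $J$ is the complex structure of $\mathbb{C}\mathbb{P}^n$, and $JH_\Phi$ is regarded as a vector field on $M$. -/

import Mathlib

open scoped Manifold ContDiff Topology
open Module

noncomputable section

/-! ### Riemannian geometry of a manifold without boundary, in charts

`E` is the model space of `M`; a tangent vector at `p`, i.e. an element of `TangentSpace 𝓘(ℝ, E) p`,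
is represented in `E` through the preferred chart `chartAt E p`. -/

section Riemannian

variable {E : Type*} [NormedAddCommGroup E] [NormedSpace ℝ E]
variable {M : Type*} [TopologicalSpace M] [ChartedSpace E M]
variable {F : Type*} [NormedAddCommGroup F] [NormedSpace ℝ F]
variable {N : Type*} [TopologicalSpace N] [ChartedSpace F N]

variable (E M) in
/-- A field of bilinear forms on the tangent spaces of `M`. -/
abbrev MetricField :=
  ∀ p : M, TangentSpace 𝓘(ℝ, E) p →L[ℝ] TangentSpace 𝓘(ℝ, E) p →L[ℝ] ℝ

/-- The coefficients `g_{ij}` of `g` in the preferred chart at `p`, as a function of the coordinate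
`y`: the pull-back of `g` by the inverse of the chart. -/
def chartMetric (g : MetricField E M) (p : M) (y : E) : E →L[ℝ] E →L[ℝ] ℝ :=
  let A : E →L[ℝ] E := mfderiv 𝓘(ℝ, E) 𝓘(ℝ, E) (chartAt E p).symm y
  let B : E →L[ℝ] E →L[ℝ] ℝ := g ((chartAt E p).symm y)
  B.bilinearComp A A

/-- The Christoffel symbols at `y` of a metric `G` on an open subset of `E`: the linear map
`u ↦ Γ(u, v)`, determined by Koszul's formula
`2 G(Γ(u, v), w) = (D_u G)(v, w) + (D_v G)(u, w) - (D_w G)(v, u)`. -/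
def christoffel (G : E → E →L[ℝ] E →L[ℝ] ℝ) (y v : E) : E →L[ℝ] E :=
  let D : E →L[ℝ] E →L[ℝ] E →L[ℝ] ℝ := fderiv ℝ G y
  (G y).inverse ∘L ((1 / 2 : ℝ) • (D.flip v + D v - (D.flip v).flip))

/-- The covariant derivative `u ↦ ∇_u X` at `p` of the vector field `X` for the Levi-Civita
connection of `g`, computed in the preferred chart at `p`. -/
def covDeriv (g : MetricField E M) (X : ∀ p : M, TangentSpace 𝓘(ℝ, E) p) (p : M) :
    TangentSpace 𝓘(ℝ, E) p →L[ℝ] TangentSpace 𝓘(ℝ, E) p :=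
  let Xhat : E → E := fun y =>
    mfderiv 𝓘(ℝ, E) 𝓘(ℝ, E) (chartAt E p) ((chartAt E p).symm y) (X ((chartAt E p).symm y))
  (fderiv ℝ Xhat (chartAt E p p) + christoffel (chartMetric g p) (chartAt E p p) (X p) : E →L[ℝ] E)

/-- The divergence of a vector field: the trace of its covariant derivative. -/
def divergence (g : MetricField E M) (X : ∀ p : M, TangentSpace 𝓘(ℝ, E) p) (p : M) : ℝ :=
  LinearMap.trace ℝ (TangentSpace 𝓘(ℝ, E) p) (covDeriv g X p).toLinearMap

/-- The gradient of a real function: `g(∇f, v) = df(v)`. -/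
def gradientField (g : MetricField E M) (f : M → ℝ) (p : M) : TangentSpace 𝓘(ℝ, E) p :=
  (g p).inverse (mfderiv 𝓘(ℝ, E) 𝓘(ℝ, ℝ) f p)

/-- The Laplace-Beltrami operator. -/
def laplaceBeltrami (g : MetricField E M) (f : M → ℝ) (p : M) : ℝ :=
  divergence g (gradientField g f) p

/-- A smooth map `β` into the circle `ℝ / 2πℤ` (with its flat metric) is a harmonic map if, locally,
it is the class modulo `2π` of a smooth real function `b` with `Δ b = 0`. -/
def IsHarmonicAngle (g : MetricField E M) (β : M → Real.Angle) : Prop :=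
  ∀ p : M, ∃ (U : Set M) (b : M → ℝ), IsOpen U ∧ p ∈ U ∧ ContMDiffOn 𝓘(ℝ, E) 𝓘(ℝ, ℝ) ∞ b U ∧
    ∀ q ∈ U, (b q : Real.Angle) = β q ∧ laplaceBeltrami g b q = 0

/-- `f : (M, g) → (N, h)` is a smooth immersion, and `g` is the metric that it induces on `M`. -/
structure IsIsometricImmersion (g : MetricField E M) (h : MetricField F N) (f : M → N) : Prop where
  contMDiff : ContMDiff 𝓘(ℝ, E) 𝓘(ℝ, F) ∞ f
  injective : ∀ p, Function.Injective (mfderiv 𝓘(ℝ, E) 𝓘(ℝ, F) f p)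
  isometric : ∀ (p : M) (u v : TangentSpace 𝓘(ℝ, E) p),
    h (f p) (mfderiv 𝓘(ℝ, E) 𝓘(ℝ, F) f p u) (mfderiv 𝓘(ℝ, E) 𝓘(ℝ, F) f p v) = g p u v

/-- The second fundamental form `σ(u, v) = ∇ʰ_u (f_* v) - f_* (∇ᵍ_u v)` of an isometric immersion
`f : (M, g) → (N, h)` at `p`, in the preferred charts at `p` and at `f p`. -/
def secondFundamentalForm (g : MetricField E M) (h : MetricField F N) (f : M → N) (p : M)
    (u v : TangentSpace 𝓘(ℝ, E) p) : TangentSpace 𝓘(ℝ, F) (f p) :=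
  let fhat : E → F := fun y => chartAt F (f p) (f ((chartAt E p).symm y))
  let y : E := chartAt E p p
  let D : E →L[ℝ] F := fderiv ℝ fhat y
  (fderiv ℝ (fderiv ℝ fhat) y u v
    + christoffel (chartMetric h (f p)) (chartAt F (f p) (f p)) (D v) (D u)
    - D (christoffel (chartMetric g p) y v u) : F)

/-- The mean curvature vector `H = (1/n) tr_g σ`, where `n = dim M`. The trace is written as
`∑ i, σ(bᵢ, (bⁱ)♯)` for a basis `bᵢ` of the tangent space and its dual basis `bⁱ`, i.e. as
`g^{ij} σ(bᵢ, bⱼ)`. -/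
def meanCurvature [FiniteDimensional ℝ E] (g : MetricField E M) (h : MetricField F N) (f : M → N)
    (p : M) : TangentSpace 𝓘(ℝ, F) (f p) :=
  let b := finBasis ℝ E
  (1 / finrank ℝ E : ℝ) •
    ∑ i, secondFundamentalForm g h f p (b i) ((g p).inverse (b.coord i).toContinuousLinearMap)

/-- An orientation of the manifold `M`: an orientation of every tangent space, locally constant
in the local trivializations of the tangent bundle. -/
def IsManifoldOrientation [IsManifold 𝓘(ℝ, E) 1 M] {ι : Type*}
    (o : ∀ p : M, Orientation ℝ (TangentSpace 𝓘(ℝ, E) p) ι) : Prop :=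
  ∀ p : M, ∀ᶠ q in 𝓝 p,
    ∃ hq : q ∈ (trivializationAt E (TangentSpace 𝓘(ℝ, E)) p).baseSet,
      Orientation.map ι
        ((trivializationAt E (TangentSpace 𝓘(ℝ, E)) p).continuousLinearEquivAt ℝ q hq).toLinearEquiv
        (o q) = (o p : Orientation ℝ E ι)

end Riemannian

/-! ### The sphere `S^{2n+1}` in `ℂ^{n+1}` and Legendrian immersions -/

/-- `ℝ^n`. -/
abbrev RSpace (n : ℕ) := EuclideanSpace ℝ (Fin n)

/-- `ℂ^n`, with the real inner product `Re ⟨·, ·⟩` and the complex structure `v ↦ i v`. -/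
abbrev CSpace (n : ℕ) := EuclideanSpace ℂ (Fin n)

/-- The unit sphere of `ℂ^{n+1}`. -/
abbrev OddSphere (n : ℕ) := Metric.sphere (0 : CSpace (n + 1)) 1

/-- The real inner product `Re ⟨u, v⟩` of `ℂ^n`. -/
def realInner (n : ℕ) : CSpace n →L[ℝ] CSpace n →L[ℝ] ℝ := innerSL ℝ

lemma realInner_apply {n : ℕ} (u v : CSpace n) : realInner n u v = (inner ℂ u v).re := by
  change inner ℝ u v = _
  simp [PiLp.inner_apply]

instance finrank_CSpace_fact (n : ℕ) : Fact (finrank ℝ (CSpace (n + 1)) = (2 * n + 1) + 1) :=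
  ⟨by rw [finrank_real_of_complex, finrank_euclideanSpace, Fintype.card_fin]; ring⟩

/-- The differential `T_z S^{2n+1} → ℂ^{n+1}` of the inclusion. -/
def sphereIncl {n : ℕ} (z : OddSphere n) :
    TangentSpace 𝓘(ℝ, RSpace (2 * n + 1)) z →L[ℝ] CSpace (n + 1) :=
  mfderiv 𝓘(ℝ, RSpace (2 * n + 1)) 𝓘(ℝ, CSpace (n + 1))
    ((↑) : OddSphere n → CSpace (n + 1)) z

/-- The round metric of `S^{2n+1}`, induced from `ℂ^{n+1}`. -/
def roundMetric (n : ℕ) : MetricField (RSpace (2 * n + 1)) (OddSphere n) := fun z =>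
  let A : RSpace (2 * n + 1) →L[ℝ] CSpace (n + 1) := sphereIncl z
  (realInner (n + 1)).bilinearComp A A

/-- The Liouville form `Λ_z(v) = ⟨v, J z⟩` of `ℂ^{n+1}`. -/
def liouville {n : ℕ} (z v : CSpace (n + 1)) : ℝ := realInner (n + 1) v (Complex.I • z)

/-- The complex `n`-form `Ω_z(v₁, …, vₙ) = det_ℂ (z, v₁, …, vₙ)`. -/
def complexVolume {n : ℕ} (z : CSpace (n + 1)) (v : Fin n → CSpace (n + 1)) : ℂ :=
  Matrix.det (Matrix.of fun i k => (Fin.cons z v : Fin (n + 1) → CSpace (n + 1)) i k)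

section Legendrian

variable {n : ℕ} {M : Type*} [TopologicalSpace M] [ChartedSpace (RSpace n) M]

/-- The differential of `φ : M → S^{2n+1}`, with values in `ℂ^{n+1}`. -/
def sphereDeriv (φ : M → OddSphere n) (p : M) :
    TangentSpace 𝓘(ℝ, RSpace n) p →L[ℝ] CSpace (n + 1) :=
  sphereIncl (φ p) ∘L mfderiv 𝓘(ℝ, RSpace n) 𝓘(ℝ, RSpace (2 * n + 1)) φ p

/-- `φ : M → S^{2n+1}` is a Legendrian immersion of the `n`-dimensional manifold `M`, whose induced
metric is `g`. -/
structure IsLegendrianImmersion (g : MetricField (RSpace n) M) (φ : M → OddSphere n) : Prop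
    extends IsIsometricImmersion g (roundMetric n) φ where
  legendrian : ∀ (p : M) (v : TangentSpace 𝓘(ℝ, RSpace n) p),
    liouville (φ p : CSpace (n + 1)) (sphereDeriv φ p v) = 0

/-- `φ` is C-minimal: `div JH = 0`, where `JH` is regarded as the vector field `X` on `M` with
`φ_* X = J H`, and `H` is the mean curvature vector of `φ` in the sphere. -/
def IsCMinimal (g : MetricField (RSpace n) M) (φ : M → OddSphere n) : Prop :=
  ∃ X : ∀ p : M, TangentSpace 𝓘(ℝ, RSpace n) p,
    (∀ p, sphereDeriv φ p (X p) =
      Complex.I • sphereIncl (φ p) (meanCurvature g (roundMetric n) φ p)) ∧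
    ∀ p, divergence g X p = 0

open Classical in
/-- `β : M → ℝ / 2πℤ` is the Legendrian angle of `φ` for the orientation `o`:
`e^{iβ(p)} = (φ^* Ω)_p (e₁, …, eₙ)` for oriented orthonormal bases of `T_p M`. Equivalently (and so
that a negatively oriented point is covered when `n = 0`), `(φ^* Ω)_p (e₁, …, eₙ) = ± e^{iβ(p)}` for
every orthonormal basis, with the sign of its orientation. -/
def IsLegendrianAngle (g : MetricField (RSpace n) M) (φ : M → OddSphere n)
    (o : ∀ p : M, Orientation ℝ (TangentSpace 𝓘(ℝ, RSpace n) p) (Fin n))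
    (β : M → Real.Angle) : Prop :=
  ∀ (p : M) (e : Basis (Fin n) ℝ (TangentSpace 𝓘(ℝ, RSpace n) p)),
    (∀ i j, g p (e i) (e j) = if i = j then 1 else 0) →
    complexVolume (φ p : CSpace (n + 1)) (fun i => sphereDeriv φ p (e i)) =
      (if e.orientation = o p then 1 else -1) * ((β p).toCircle : ℂ)

end Legendrian

/-! ### Complex projective space -/

/-- `ℂP^n`, the space of complex lines in `ℂ^{n+1}`. -/
abbrev CProj (n : ℕ) := Projectivization ℂ (CSpace (n + 1))

namespace CProj

variable {n : ℕ}

/-- The quotient topology. -/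
instance : TopologicalSpace (CProj n) :=
  TopologicalSpace.coinduced (Projectivization.mk' ℂ (V := CSpace (n + 1))) inferInstance

/-- The projection from the nonzero vectors. -/
abbrev proj (n : ℕ) : {z : CSpace (n + 1) // z ≠ 0} → CProj n := Projectivization.mk' ℂ

lemma isQuotientMap_proj : Topology.IsQuotientMap (proj n) :=
  ⟨⟨rfl⟩, Quotient.mk''_surjective⟩

/-- Points at which the `j`-th homogeneous coordinate does not vanish. -/
def affineSource (j : Fin (n + 1)) : Set (CProj n) := {q | q.rep j ≠ 0}

lemma mk_mem_affineSource (j : Fin (n + 1)) (z : CSpace (n + 1)) (hz : z ≠ 0) :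
    Projectivization.mk ℂ z hz ∈ affineSource j ↔ z j ≠ 0 := by
  obtain ⟨a, ha⟩ := Projectivization.exists_smul_eq_mk_rep ℂ z hz
  simp [affineSource, ← ha, Units.smul_def]

/-- The affine coordinates `[z] ↦ (z_k / z_j)_{k ≠ j}`. -/
def affineCoord (j : Fin (n + 1)) (q : CProj n) : CSpace n :=
  WithLp.toLp 2 fun k => q.rep (j.succAbove k) / q.rep j

lemma affineCoord_mk (j : Fin (n + 1)) (z : CSpace (n + 1)) (hz : z ≠ 0) :
    affineCoord j (Projectivization.mk ℂ z hz) =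
      WithLp.toLp 2 fun k => z (j.succAbove k) / z j := by
  obtain ⟨a, ha⟩ := Projectivization.exists_smul_eq_mk_rep ℂ z hz
  ext k
  simp [affineCoord, ← ha, Units.smul_def, mul_div_mul_left]

/-- The vector with `j`-th coordinate `1` and other coordinates `w`. -/
def affineVec (j : Fin (n + 1)) (w : CSpace n) : CSpace (n + 1) :=
  WithLp.toLp 2 (j.insertNth (α := fun _ => ℂ) 1 w)

@[simp] lemma affineVec_same (j : Fin (n + 1)) (w : CSpace n) : affineVec j w j = 1 := by
  simp [affineVec]

@[simp] lemma affineVec_succAbove (j : Fin (n + 1)) (w : CSpace n) (k : Fin n) :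
    affineVec j w (j.succAbove k) = w k := by
  simp [affineVec]

lemma affineVec_ne_zero (j : Fin (n + 1)) (w : CSpace n) : affineVec j w ≠ 0 := by
  intro h
  have := affineVec_same j w
  simp [h] at this

lemma contDiff_affineVec (j : Fin (n + 1)) : ContDiff ℝ ∞ (affineVec (n := n) j) := by
  rw [contDiff_piLp]
  intro i
  induction i using Fin.succAboveCases j with
  | x => simpa using contDiff_const
  | p k => simpa using ((contDiff_piLp 2).1 contDiff_id k)

/-- The `j`-th affine chart of `ℂP^n`. -/
def affineChart (j : Fin (n + 1)) : OpenPartialHomeomorph (CProj n) (CSpace n) where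
  toFun := affineCoord j
  invFun w := Projectivization.mk ℂ (affineVec j w) (affineVec_ne_zero j w)
  source := affineSource j
  target := Set.univ
  map_source' _ _ := trivial
  map_target' w _ := by simp [mk_mem_affineSource]
  left_inv' q hq := by
    induction q using Projectivization.ind with | h z hz => ?_
    rw [mk_mem_affineSource] at hq
    rw [Projectivization.mk_eq_mk_iff']
    refine ⟨(z j)⁻¹, ?_⟩
    ext i
    induction i using Fin.succAboveCases j with
    | x => simp [hq]
    | p k => simp [affineCoord_mk, div_eq_inv_mul]
  right_inv' w _ := by
    ext k
    simp [affineCoord_mk]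
  open_source := by
    rw [← isQuotientMap_proj.isOpen_preimage]
    have : proj n ⁻¹' affineSource j = {z | z.1 j ≠ 0} := by
      ext z
      exact mk_mem_affineSource j z.1 z.2
    rw [this]
    exact isOpen_ne_fun (by fun_prop) continuous_const
  open_target := isOpen_univ
  continuousOn_toFun := by
    have hopen : IsOpen (affineSource j) := by
      rw [← isQuotientMap_proj.isOpen_preimage]
      have : proj n ⁻¹' affineSource j = {z | z.1 j ≠ 0} := by
        ext z
        exact mk_mem_affineSource j z.1 z.2
      rw [this]
      exact isOpen_ne_fun (by fun_prop) continuous_const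
    rw [isQuotientMap_proj.continuousOn_isOpen_iff hopen]
    have h : affineCoord j ∘ proj n =
        fun z => WithLp.toLp 2 fun k => z.1 (j.succAbove k) / z.1 j := by
      funext z
      exact affineCoord_mk j z.1 z.2
    rw [h]
    refine (PiLp.continuous_toLp 2 _).comp_continuousOn ?_
    refine continuousOn_pi.2 fun k => ContinuousOn.div (by fun_prop) (by fun_prop) ?_
    intro z hz
    exact (mk_mem_affineSource j z.1 z.2).1 hz
  continuousOn_invFun := by
    refine Continuous.continuousOn ?_
    exact isQuotientMap_proj.continuous.comp
      (((contDiff_affineVec j).continuous).subtype_mk (affineVec_ne_zero j))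

lemma exists_mem_affineSource (q : CProj n) : ∃ j : Fin (n + 1), q ∈ affineSource j := by
  by_contra h
  apply q.rep_nonzero
  ext j
  simpa [affineSource] using not_exists.1 h j

/-- `ℂP^n` with the atlas of the `n + 1` affine charts. -/
instance : ChartedSpace (CSpace n) (CProj n) where
  atlas := Set.range affineChart
  chartAt q := affineChart (exists_mem_affineSource q).choose
  mem_chart_source q := (exists_mem_affineSource q).choose_spec
  chart_mem_atlas _ := Set.mem_range_self _

instance : IsManifold 𝓘(ℝ, CSpace n) ∞ (CProj n) := by
  refine isManifold_of_contDiffOn 𝓘(ℝ, CSpace n) ∞ (CProj n) ?_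
  rintro _ _ ⟨i, rfl⟩ ⟨j, rfl⟩
  have h : ∀ w, affineCoord j ((affineChart i).symm w) =
      WithLp.toLp 2 fun k => affineVec i w (j.succAbove k) / affineVec i w j := fun w =>
    affineCoord_mk j _ (affineVec_ne_zero i w)
  have hs : ∀ w, (affineChart i).symm w ∈ (affineChart j).source → affineVec i w j ≠ 0 :=
    fun w hw => (mk_mem_affineSource j _ (affineVec_ne_zero i w)).1 hw
  have hc : ∀ k, ContDiff ℝ ∞ fun w : CSpace n => affineVec i w k := fun k =>
    (contDiff_piLp 2).1 (contDiff_affineVec i) k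
  have : ContDiffOn ℝ ∞ (fun w : CSpace n =>
      (WithLp.toLp 2 fun k => affineVec i w (j.succAbove k) / affineVec i w j : CSpace n))
      {w | affineVec i w j ≠ 0} := by
    rw [contDiffOn_piLp]
    intro k
    simp only [div_eq_mul_inv]
    exact (hc _).contDiffOn.mul ((hc j).contDiffOn.inv fun w hw => hw)
  refine (this.congr fun w _ => h w).mono ?_
  intro w hw
  simp only [mfld_simps] at hw
  exact hs w hw.2

/-- The complex structure `J` of `ℂP^n`: multiplication by `i` in the (holomorphic) affine
charts. -/
def complexStructure (q : CProj n) :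
    TangentSpace 𝓘(ℝ, CSpace n) q →L[ℝ] TangentSpace 𝓘(ℝ, CSpace n) q :=
  (LinearMap.restrictScalars ℝ (Complex.I • LinearMap.id : CSpace n →ₗ[ℂ] CSpace n)
    ).toContinuousLinearMap

/-- The Fubini-Study metric of holomorphic sectional curvature 4 at the point with affine
coordinates `w`, as a real bilinear form. -/
def fubiniStudyForm (w : CSpace n) : CSpace n →L[ℝ] CSpace n →L[ℝ] ℝ :=
  (1 + ‖w‖ ^ 2)⁻¹ • realInner n
    - ((1 + ‖w‖ ^ 2) ^ 2)⁻¹ •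
      ((realInner n w).smulRight (realInner n w)
        + (realInner n (Complex.I • w)).smulRight (realInner n (Complex.I • w)))

/-- The usual formula for the Fubini-Study metric. -/
lemma fubiniStudyForm_apply (w u v : CSpace n) :
    fubiniStudyForm w u v =
      (((1 + ‖w‖ ^ 2) * inner ℂ u v - inner ℂ u w * inner ℂ w v) / (1 + ‖w‖ ^ 2) ^ 2 : ℂ).re := by
  have hsym : (inner ℂ w u : ℂ) = (starRingEnd ℂ) (inner ℂ u w) := (inner_conj_symm w u).symm
  have hpos : (1 + ‖w‖ ^ 2 : ℝ) ≠ 0 := by positivity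
  have hcast : ((1 + (‖w‖ : ℂ) ^ 2) : ℂ) = ((1 + ‖w‖ ^ 2 : ℝ) : ℂ) := by push_cast; rfl
  rw [hcast, ← Complex.ofReal_pow, Complex.div_ofReal_re]
  simp only [fubiniStudyForm, sub_apply, smul_apply,
    add_apply, ContinuousLinearMap.smulRight_apply, realInner_apply,
    inner_smul_left, hsym, smul_eq_mul]
  generalize (inner ℂ u w : ℂ) = a
  generalize (inner ℂ w v : ℂ) = b
  generalize (inner ℂ u v : ℂ) = c
  simp only [Complex.sub_re, Complex.mul_re, Complex.conj_re, Complex.conj_im, Complex.conj_I,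
    Complex.neg_re, Complex.neg_im, Complex.I_re, Complex.I_im, Complex.ofReal_re,
    Complex.ofReal_im]
  field_simp
  ring

/-- The Fubini-Study metric of `ℂP^n`. -/
def fubiniStudy (n : ℕ) : MetricField (CSpace n) (CProj n) := fun q =>
  fubiniStudyForm (chartAt (CSpace n) q q)

/-- The Hopf fibration `Π(z) = [z]`. -/
def hopf (z : OddSphere n) : CProj n :=
  Projectivization.mk ℂ (z : CSpace (n + 1)) (ne_zero_of_mem_unit_sphere z)

end CProj

section Lagrangian

variable {n : ℕ} {M : Type*} [TopologicalSpace M] [ChartedSpace (RSpace n) M]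

/-- `Φ : M → ℂP^n` is a Lagrangian immersion of the `n`-dimensional manifold `M`, whose induced
metric is `g`: the pull-back by `Φ` of the Kähler form `ω = ⟨J ·, ·⟩` vanishes. -/
structure IsLagrangianImmersion (g : MetricField (RSpace n) M) (Φ : M → CProj n) : Prop
    extends IsIsometricImmersion g (CProj.fubiniStudy n) Φ where
  lagrangian : ∀ (p : M) (u v : TangentSpace 𝓘(ℝ, RSpace n) p),
    CProj.fubiniStudy n (Φ p)
      (CProj.complexStructure (Φ p) (mfderiv 𝓘(ℝ, RSpace n) 𝓘(ℝ, CSpace n) Φ p u))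
      (mfderiv 𝓘(ℝ, RSpace n) 𝓘(ℝ, CSpace n) Φ p v) = 0

/-- `Φ` is H-minimal: `div JH = 0`, where `JH` is regarded as the vector field `X` on `M` with
`Φ_* X = J H`, and `H` is the mean curvature vector of `Φ` in `ℂP^n`. -/
def IsHMinimal (g : MetricField (RSpace n) M) (Φ : M → CProj n) : Prop :=
  ∃ X : ∀ p : M, TangentSpace 𝓘(ℝ, RSpace n) p,
    (∀ p, mfderiv 𝓘(ℝ, RSpace n) 𝓘(ℝ, CSpace n) Φ p (X p) =
      CProj.complexStructure (Φ p) (meanCurvature g (CProj.fubiniStudy n) Φ p)) ∧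
    ∀ p, divergence g X p = 0

end Lagrangian

end

/-! Everything is read off from the map `f` into `ℂ^{n+1}` that expresses `φ` in a chart.
Differentiating `|f| = 1` and the Legendrian condition shows that `df` is orthogonal to `f` and
`Jf`, that `df(u) ⊥ J df(v)`, that `D²f ⊥ Jf`, and that the cubic form `C(u,v,w) = ⟨D²f(u,v), J
df(w)⟩` is totally symmetric (`IsLocalLegendrian.lagrangian`, `IsLocalLegendrian.cubic_symm`). Hence
`f` together with the image of an orthonormal frame is a unitary basis.

Angle. By Gauss' formula the second fundamental form in the sphere is `D²f - df Γ + g f`. So `H` is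
orthogonal to `f`, `Jf` and the image of `df`; therefore `JH` is tangent and `g(JH, w) = -(1/n) ∑
C(e_k, e_k, w)` (`coordMetric_of_coordDeriv_eq`). On the other side, the logarithmic derivative of
`det(f, df e_1, …, df e_n)` at a unitary basis is a sum of Hermitian products, and by the symmetry
of `C` its imaginary part along `w` is `∑ C(e_k, e_k, w)` (`exists_hasFDerivAt_localVolume`). This
imaginary part is `dβ(w)`, so `∇β = -n JH` (`gradientField_eq`) and `Δβ = -n div JH`. When `n = 0`
all divergences vanish. Continuity of the orientation gives smooth local determinations of `β`
(`exists_local_determination`).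

Hopf fibration. The Fubini-Study metric, pulled back to `ℂ^{n+1} ∖ {0}`, is the explicit form
`hopfForm`. It is Euclidean on horizontal vectors at unit points, and its Christoffel symbols of the
first kind vanish on pairs of horizontal vectors with real Hermitian product (`koszul_hopfForm`).
The image of `df` consists of such vectors, so `Φ` induces the same metric and its second
fundamental form is the projection of that of `φ` (`secondFundamentalForm_hopf_comp`). The
projection commutes with `J`, so one and the same field on `M` represents `JH` and `JH_Φ`, and the
two minimality conditions coincide. -/

set_option maxSynthPendingDepth 3

noncomputable section

/-! ### Nondegenerate forms and metric traces -/

section BilinearForms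

variable {E : Type*} [NormedAddCommGroup E] [NormedSpace ℝ E] [FiniteDimensional ℝ E]

lemma ContinuousLinearMap.isInvertible_of_ker_eq_zero {B : E →L[ℝ] E →L[ℝ] ℝ}
    (hB : ∀ u, B u = 0 → u = 0) : B.IsInvertible := by
  have hfin : finrank ℝ E = finrank ℝ (E →L[ℝ] ℝ) := by
    rw [← (LinearMap.toContinuousLinearMap (𝕜 := ℝ) (E := E) (F' := ℝ)).finrank_eq]
    exact (Subspace.dual_finrank_eq (K := ℝ) (V := E)).symm
  have hinj : Function.Injective B.toLinearMap :=
    (injective_iff_map_eq_zero _).2 hB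
  refine ⟨(LinearEquiv.ofInjectiveOfFinrankEq B.toLinearMap hinj hfin).toContinuousLinearEquiv, ?_⟩
  ext u v
  rfl

/-- `ContinuousLinearMap.inverse` takes the value zero on maps that are not invertible, so raising
an index has its meaning only once nondegeneracy is known. -/
lemma ContinuousLinearMap.apply_inverse_apply {B : E →L[ℝ] E →L[ℝ] ℝ}
    (hB : ∀ u, B u = 0 → u = 0) (l : E →L[ℝ] ℝ) : B (B.inverse l) = l := by
  obtain ⟨e, rfl⟩ := ContinuousLinearMap.isInvertible_of_ker_eq_zero hB
  simp

/-- The metric trace of a bilinear map can be computed in any orthonormal basis. -/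
lemma sum_dual_eq_sum_orthonormal {ι κ : Type*} [Fintype ι] [Fintype κ] [DecidableEq κ]
    {g : E →L[ℝ] E →L[ℝ] ℝ} (hg : ∀ u, g u = 0 → u = 0)
    (b : Basis ι ℝ E) (e : Basis κ ℝ E) (he : ∀ i j, g (e i) (e j) = if i = j then 1 else 0)
    (B : E →ₗ[ℝ] E →ₗ[ℝ] ℝ) :
    ∑ i, B (b i) (g.inverse (b.coord i).toContinuousLinearMap) = ∑ k, B (e k) (e k) := by
  have hexp : ∀ u, u = ∑ k, g u (e k) • e k := by
    intro u
    conv_lhs => rw [← e.sum_repr u]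
    refine Finset.sum_congr rfl fun k _ => ?_
    congr 1
    have := congrArg (fun x => g x (e k)) (e.sum_repr u)
    simp only [map_sum, map_smul, sum_apply, smul_apply, smul_eq_mul, he, mul_ite, mul_one,
      mul_zero, Finset.sum_ite_eq', Finset.mem_univ, if_true] at this
    exact this
  have h1 : ∀ i, g.inverse (b.coord i).toContinuousLinearMap = ∑ k, b.coord i (e k) • e k := by
    intro i
    conv_lhs => rw [hexp (g.inverse _), ContinuousLinearMap.apply_inverse_apply hg]
    rfl
  have h2 : ∀ k l, ∑ i, g (b i) (e k) * b.coord i (e l) = if l = k then 1 else 0 := by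
    intro k l
    rw [← he l k]
    have := congrArg (fun x => g x (e k)) (b.sum_repr (e l))
    simp only [map_sum, map_smul, sum_apply, smul_apply, smul_eq_mul] at this
    rw [← this]
    exact Finset.sum_congr rfl fun i _ => mul_comm _ _
  calc ∑ i, B (b i) (g.inverse (b.coord i).toContinuousLinearMap)
      = ∑ i, ∑ k, ∑ l, (g (b i) (e k) * b.coord i (e l)) * B (e k) (e l) := by
        refine Finset.sum_congr rfl fun i _ => ?_
        rw [h1]
        conv_lhs => rw [hexp (b i)]
        simp only [map_sum, map_smul, LinearMap.sum_apply, LinearMap.smul_apply, smul_eq_mul,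
          Finset.mul_sum]
        rw [Finset.sum_comm]
        refine Finset.sum_congr rfl fun k _ => Finset.sum_congr rfl fun l _ => ?_
        ring
    _ = ∑ k, ∑ l, (∑ i, g (b i) (e k) * b.coord i (e l)) * B (e k) (e l) := by
        rw [Finset.sum_comm]
        refine Finset.sum_congr rfl fun k _ => ?_
        rw [Finset.sum_comm]
        refine Finset.sum_congr rfl fun l _ => ?_
        rw [Finset.sum_mul]
    _ = ∑ k, B (e k) (e k) := by
        simp only [h2, ite_mul, one_mul, zero_mul, Finset.sum_ite_eq', Finset.mem_univ, if_true]

end BilinearForms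

/-! ### Christoffel symbols under pull-back -/

section Koszul

variable {E : Type*} [NormedAddCommGroup E] [NormedSpace ℝ E]
variable {F : Type*} [NormedAddCommGroup F] [NormedSpace ℝ F]

/-- The Christoffel symbols of the first kind of a field of bilinear forms. -/
def koszul (G : E → E →L[ℝ] E →L[ℝ] ℝ) (y u v w : E) : ℝ :=
  (1 / 2) * (fderiv ℝ G y u v w + fderiv ℝ G y v u w - fderiv ℝ G y w v u)

lemma koszul_const (B : E →L[ℝ] E →L[ℝ] ℝ) (y u v w : E) :
    koszul (fun _ => B) y u v w = 0 := by
  simp [koszul]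

lemma Filter.EventuallyEq.koszul_eq {G H : E → E →L[ℝ] E →L[ℝ] ℝ} {y : E} (h : G =ᶠ[𝓝 y] H)
    (u v w : E) : koszul G y u v w = koszul H y u v w := by
  simp [koszul, h.fderiv_eq]

lemma apply_christoffel [FiniteDimensional ℝ E] {G : E → E →L[ℝ] E →L[ℝ] ℝ} {y : E}
    (hG : ∀ u, G y u = 0 → u = 0) (u v w : E) :
    G y (christoffel G y v u) w = koszul G y u v w := by
  simp only [christoffel, ContinuousLinearMap.comp_apply]
  rw [ContinuousLinearMap.apply_inverse_apply hG]
  simp [koszul]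

lemma christoffel_smul (G : E → E →L[ℝ] E →L[ℝ] ℝ) (y v : E) (c : ℝ) :
    christoffel G y (c • v) = c • christoffel G y v := by
  unfold christoffel
  simp only [map_smul, ← ContinuousLinearMap.comp_smul]
  congr 1
  ext a b
  simp
  ring

/-- The pull-back of a field of bilinear forms. -/
def pullbackForm (P : E → F) (H : F → F →L[ℝ] F →L[ℝ] ℝ) (y : E) : E →L[ℝ] E →L[ℝ] ℝ :=
  (H (P y)).bilinearComp (fderiv ℝ P y) (fderiv ℝ P y)

@[simp] lemma pullbackForm_apply (P : E → F) (H : F → F →L[ℝ] F →L[ℝ] ℝ) (y u v : E) :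
    pullbackForm P H y u v = H (P y) (fderiv ℝ P y u) (fderiv ℝ P y v) := rfl

lemma fderiv_apply_apply {G : E → E →L[ℝ] E →L[ℝ] ℝ} {y : E} (h : DifferentiableAt ℝ G y)
    (u v w : E) : fderiv ℝ (fun x => G x v w) y u = fderiv ℝ G y u v w := by
  have h1 := (h.hasFDerivAt.clm_apply (hasFDerivAt_const v y)).clm_apply (hasFDerivAt_const w y)
  rw [h1.fderiv]
  simp

lemma differentiableAt_pullbackForm {P : E → F} {H : F → F →L[ℝ] F →L[ℝ] ℝ} {y : E}
    (hP : ContDiffAt ℝ 2 P y) (hH : DifferentiableAt ℝ H (P y)) :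
    DifferentiableAt ℝ (pullbackForm P H) y := by
  have h1 : DifferentiableAt ℝ (fderiv ℝ P) y :=
    (hP.fderiv_right (m := 1) (by norm_num)).differentiableAt (by norm_num)
  have h2 : DifferentiableAt ℝ (fun x => H (P x)) y :=
    DifferentiableAt.comp (g := H) y hH (hP.differentiableAt (by norm_num))
  -- Precomposition is done one slot at a time; the flip brings the other slot to the front.
  have h3 := (ContinuousLinearMap.flipₗᵢ ℝ E F ℝ).differentiableAt.comp y (h2.clm_comp h1)
  exact (ContinuousLinearMap.flipₗᵢ ℝ E E ℝ).differentiableAt.comp y (h3.clm_comp h1)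

lemma fderiv_pullbackForm {P : E → F} {H : F → F →L[ℝ] F →L[ℝ] ℝ} {y : E}
    (hP : ContDiffAt ℝ 2 P y) (hH : DifferentiableAt ℝ H (P y)) (u v w : E) :
    fderiv ℝ (pullbackForm P H) y u v w =
      fderiv ℝ H (P y) (fderiv ℝ P y u) (fderiv ℝ P y v) (fderiv ℝ P y w)
      + H (P y) (fderiv ℝ (fderiv ℝ P) y u v) (fderiv ℝ P y w)
      + H (P y) (fderiv ℝ P y v) (fderiv ℝ (fderiv ℝ P) y u w) := by
  rw [← fderiv_apply_apply (differentiableAt_pullbackForm hP hH)]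
  have h0 := (hP.differentiableAt (by norm_num)).hasFDerivAt
  have h1 : HasFDerivAt (fderiv ℝ P) _ y :=
    ((hP.fderiv_right (m := 1) (by norm_num)).differentiableAt (by norm_num)).hasFDerivAt
  have h2 : HasFDerivAt (fun x => H (P x)) _ y :=
    HasFDerivAt.comp (g := H) y hH.hasFDerivAt h0
  have h3 := (h2.clm_apply (h1.clm_apply (hasFDerivAt_const v y))).clm_apply
    (h1.clm_apply (hasFDerivAt_const w y))
  have h4 : HasFDerivAt (fun x => pullbackForm P H x v w) _ y := h3
  rw [h4.fderiv]
  simp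
  ring

/-- The inhomogeneous transformation law of Christoffel symbols. Six terms of the Koszul combination
contain `D²P`; by the symmetry of `D²P` and of `H`, four cancel and the other two are equal, which
absorbs the factor `1/2`. -/
lemma koszul_pullbackForm {P : E → F} {H : F → F →L[ℝ] F →L[ℝ] ℝ} {y : E}
    (hP : ContDiffAt ℝ 2 P y) (hH : DifferentiableAt ℝ H (P y))
    (hsymm : ∀ a b, H (P y) a b = H (P y) b a) (u v w : E) :
    koszul (pullbackForm P H) y u v w =
      H (P y) (fderiv ℝ (fderiv ℝ P) y u v) (fderiv ℝ P y w)
      + koszul H (P y) (fderiv ℝ P y u) (fderiv ℝ P y v) (fderiv ℝ P y w) := by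
  have hs : IsSymmSndFDerivAt ℝ P y := hP.isSymmSndFDerivAt (by simp)
  simp only [koszul, fderiv_pullbackForm hP hH]
  rw [hs v u, hs w v, hs w u, hsymm (fderiv ℝ P y v), hsymm (fderiv ℝ P y u),
    hsymm (fderiv ℝ (fderiv ℝ P) y v w)]
  ring

lemma koszul_pullbackForm_const {P : E → F} {B : F →L[ℝ] F →L[ℝ] ℝ} {y : E}
    (hP : ContDiffAt ℝ 2 P y) (hsymm : ∀ a b, B a b = B b a) (u v w : E) :
    koszul (pullbackForm P fun _ => B) y u v w =
      B (fderiv ℝ (fderiv ℝ P) y u v) (fderiv ℝ P y w) := by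
  rw [koszul_pullbackForm hP (differentiableAt_const _) hsymm, koszul_const, add_zero]

/-- The second derivative of a composition. -/
lemma fderiv_fderiv_comp {V : Type*} [NormedAddCommGroup V] [NormedSpace ℝ V] {Q : F → V}
    {P : E → F} {y : E} (hQ : ContDiffAt ℝ 2 Q (P y)) (hP : ContDiffAt ℝ 2 P y) (u v : E) :
    fderiv ℝ (fderiv ℝ (fun x => Q (P x))) y u v =
      fderiv ℝ (fderiv ℝ Q) (P y) (fderiv ℝ P y u) (fderiv ℝ P y v)
      + fderiv ℝ Q (P y) (fderiv ℝ (fderiv ℝ P) y u v) := by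
  have hev : fderiv ℝ (fun x => Q (P x)) =ᶠ[𝓝 y]
      fun x => (fderiv ℝ Q (P x)).comp (fderiv ℝ P x) := by
    have h1 := hP.eventually (by simp)
    have h2 := hP.continuousAt.eventually (hQ.eventually (by simp))
    filter_upwards [h1, h2] with x hx1 hx2
    exact fderiv_comp x (hx2.differentiableAt (by norm_num)) (hx1.differentiableAt (by norm_num))
  rw [hev.fderiv_eq]
  have h0 := (hP.differentiableAt (by norm_num)).hasFDerivAt
  have h1 : HasFDerivAt (fderiv ℝ P) _ y :=
    ((hP.fderiv_right (m := 1) (by norm_num)).differentiableAt (by norm_num)).hasFDerivAt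
  have h2 : HasFDerivAt (fderiv ℝ Q) _ (P y) :=
    ((hQ.fderiv_right (m := 1) (by norm_num)).differentiableAt (by norm_num)).hasFDerivAt
  have h3 : HasFDerivAt (fun x => fderiv ℝ Q (P x)) _ y := h2.comp y h0
  rw [(h3.clm_comp h1).fderiv]
  simp
  abel

end Koszul

/-! ### Preferred charts and coordinates of tangent vectors -/

section ChartPoints

variable {E : Type*} [NormedAddCommGroup E]
variable {M : Type*} [TopologicalSpace M] [ChartedSpace E M]

lemma eventually_mem_chart_target (p : M) : ∀ᶠ y in 𝓝 (chartAt E p p), y ∈ (chartAt E p).target :=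
  (chartAt E p).open_target.mem_nhds (mem_chart_target E p)

lemma chart_symm_chart (p : M) : (chartAt E p).symm (chartAt E p p) = p :=
  (chartAt E p).left_inv (mem_chart_source E p)

end ChartPoints

section Charts

variable {E : Type*} [NormedAddCommGroup E] [NormedSpace ℝ E]
variable {M : Type*} [TopologicalSpace M] [ChartedSpace E M]
variable {V : Type*} [NormedAddCommGroup V] [NormedSpace ℝ V]

/-- The derivative of the inverse of the preferred chart at `p`. -/
def chartSymmDeriv (p : M) (y : E) : E →L[ℝ] E :=
  mfderiv 𝓘(ℝ, E) 𝓘(ℝ, E) (chartAt E p).symm y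

lemma chartMetric_apply (g : MetricField E M) (p : M) (y u v : E) :
    chartMetric g p y u v =
      g ((chartAt E p).symm y) (chartSymmDeriv p y u) (chartSymmDeriv p y v) := rfl

section
variable [IsManifold 𝓘(ℝ, E) 1 M]

lemma mdifferentiableAt_chart_symm {p : M} {y : E} (hy : y ∈ (chartAt E p).target) :
    MDifferentiableAt 𝓘(ℝ, E) 𝓘(ℝ, E) (chartAt E p).symm y :=
  mdifferentiableAt_atlas_symm (chart_mem_atlas E p) hy

/-- Tangent vectors at `q` are represented through the chart preferred at `q`, not the one at `p`,
so differentiating the inverse chart gives the derivative of a transition map. At the centre the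
transition is the identity, and coordinate and intrinsic expressions agree there. -/
lemma chartSymmDeriv_eq {p : M} {y : E} (hy : y ∈ (chartAt E p).target) :
    chartSymmDeriv p y =
      fderiv ℝ (fun x => chartAt E ((chartAt E p).symm y) ((chartAt E p).symm x)) y := by
  unfold chartSymmDeriv
  rw [(mdifferentiableAt_chart_symm hy).mfderiv]
  simp only [writtenInExtChartAt, mfld_simps, fderivWithin_univ]
  rfl

lemma chartSymmDeriv_self (p : M) :
    chartSymmDeriv p (chartAt E p p) = ContinuousLinearMap.id ℝ E := by
  rw [chartSymmDeriv_eq (mem_chart_target E p), chart_symm_chart]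
  have : (fun x => chartAt E p ((chartAt E p).symm x)) =ᶠ[𝓝 (chartAt E p p)] id := by
    filter_upwards [eventually_mem_chart_target p] with x hx using (chartAt E p).right_inv hx
  rw [this.fderiv_eq, fderiv_id]

lemma chartMetric_self (g : MetricField E M) (p : M) (u v : E) :
    chartMetric g p (chartAt E p p) u v = g p u v := by
  rw [chartMetric_apply, chartSymmDeriv_self, chart_symm_chart]
  rfl

/-- The derivative at `q = c⁻¹(y)` of the chart `c` is a left inverse of `chartSymmDeriv`. -/
lemma mfderiv_chart_chartSymmDeriv {p : M} {y : E} (hy : y ∈ (chartAt E p).target) (u : E) :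
    mfderiv 𝓘(ℝ, E) 𝓘(ℝ, E) (chartAt E p) ((chartAt E p).symm y) (chartSymmDeriv p y u) = u := by
  have h1 := mdifferentiableAt_atlas (I := 𝓘(ℝ, E)) (chart_mem_atlas E p)
    ((chartAt E p).map_target hy)
  have h2 := mfderiv_comp y h1 (mdifferentiableAt_chart_symm hy)
  have h3 : (chartAt E p ∘ (chartAt E p).symm) =ᶠ[𝓝 y] id := by
    filter_upwards [(chartAt E p).open_target.mem_nhds hy] with x hx
      using (chartAt E p).right_inv hx
  rw [h3.mfderiv_eq, mfderiv_id] at h2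
  exact (congrArg (fun A => A u) h2).symm

lemma fderiv_comp_chart_symm {k : M → V} {p : M} {y : E} (hy : y ∈ (chartAt E p).target)
    (hk : MDifferentiableAt 𝓘(ℝ, E) 𝓘(ℝ, V) k ((chartAt E p).symm y)) (u : E) :
    fderiv ℝ (fun x => k ((chartAt E p).symm x)) y u =
      mfderiv 𝓘(ℝ, E) 𝓘(ℝ, V) k ((chartAt E p).symm y) (chartSymmDeriv p y u) := by
  have h2 := mfderiv_comp y hk (mdifferentiableAt_chart_symm hy)
  rw [mfderiv_eq_fderiv] at h2
  exact congrArg (fun A => A u) h2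

lemma fderiv_comp_chart_symm_self {k : M → V} {p : M}
    (hk : MDifferentiableAt 𝓘(ℝ, E) 𝓘(ℝ, V) k p) (u : E) :
    fderiv ℝ (fun x => k ((chartAt E p).symm x)) (chartAt E p p) u =
      mfderiv 𝓘(ℝ, E) 𝓘(ℝ, V) k p u := by
  rw [fderiv_comp_chart_symm (mem_chart_target E p) (by rwa [chart_symm_chart]),
    chartSymmDeriv_self, chart_symm_chart]
  rfl

lemma chartMetric_eq_pullbackForm {g : MetricField E M} {k : M → V} {B : V →L[ℝ] V →L[ℝ] ℝ}
    (hk : MDifferentiable 𝓘(ℝ, E) 𝓘(ℝ, V) k)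
    (hg : ∀ (p : M) (u v : TangentSpace 𝓘(ℝ, E) p), g p u v =
      B (mfderiv 𝓘(ℝ, E) 𝓘(ℝ, V) k p u) (mfderiv 𝓘(ℝ, E) 𝓘(ℝ, V) k p v))
    {p : M} {y : E} (hy : y ∈ (chartAt E p).target) :
    chartMetric g p y = pullbackForm (fun x => k ((chartAt E p).symm x)) (fun _ => B) y := by
  ext u v
  rw [chartMetric_apply, pullbackForm_apply, fderiv_comp_chart_symm hy (hk _),
    fderiv_comp_chart_symm hy (hk _)]
  exact hg _ _ _

end

lemma contDiffAt_comp_chart_symm [IsManifold 𝓘(ℝ, E) ∞ M] {k : M → V} {p : M} {y : E}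
    (hy : y ∈ (chartAt E p).target)
    (hk : ContMDiffAt 𝓘(ℝ, E) 𝓘(ℝ, V) ∞ k ((chartAt E p).symm y)) :
    ContDiffAt ℝ ∞ (fun x => k ((chartAt E p).symm x)) y := by
  rw [← contMDiffAt_iff_contDiffAt]
  exact hk.comp y (((contMDiffOn_chart_symm (I := 𝓘(ℝ, E)) (n := ∞) (x := p)) y hy).contMDiffAt
    ((chartAt E p).open_target.mem_nhds hy))

end Charts

/-! ### Locality and homogeneity of the divergence -/

section Divergence

variable {E : Type*} [NormedAddCommGroup E] [NormedSpace ℝ E]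
variable {M : Type*} [TopologicalSpace M] [ChartedSpace E M]

lemma divergence_congr {g : MetricField E M} {X Y : ∀ p : M, TangentSpace 𝓘(ℝ, E) p} {p : M}
    (h : ∀ᶠ q in 𝓝 p, X q = Y q) : divergence g X p = divergence g Y p := by
  have hc : Filter.Tendsto (chartAt E p).symm (𝓝 (chartAt E p p)) (𝓝 p) := by
    have := (chartAt E p).continuousAt_symm (mem_chart_target E p)
    rwa [ContinuousAt, chart_symm_chart] at this
  have h1 : (fun y => (mfderiv 𝓘(ℝ, E) 𝓘(ℝ, E) (chartAt E p) ((chartAt E p).symm y)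
      (X ((chartAt E p).symm y)) : E)) =ᶠ[𝓝 (chartAt E p p)]
      fun y => mfderiv 𝓘(ℝ, E) 𝓘(ℝ, E) (chartAt E p) ((chartAt E p).symm y)
        (Y ((chartAt E p).symm y)) := by
    filter_upwards [hc.eventually h] with y hy
    rw [hy]
  unfold divergence covDeriv
  rw [h.self_of_nhds]
  simp only
  rw [h1.fderiv_eq]

/-- The expression of a vector field in the preferred chart at `p`. -/
def chartField (X : ∀ p : M, TangentSpace 𝓘(ℝ, E) p) (p : M) (y : E) : E :=
  mfderiv 𝓘(ℝ, E) 𝓘(ℝ, E) (chartAt E p) ((chartAt E p).symm y) (X ((chartAt E p).symm y))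

lemma covDeriv_eq (g : MetricField E M) (X : ∀ p : M, TangentSpace 𝓘(ℝ, E) p) (p : M) :
    covDeriv g X p = (fderiv ℝ (chartField X p) (chartAt E p p) +
      christoffel (chartMetric g p) (chartAt E p p) (X p) : E →L[ℝ] E) := rfl

/-- Differentiability of `f` is not needed: for `c ≠ 0` scaling is invertible, so both sides take
the default value together. Thanks to this, regularity of the field `JH` never has to be proved. -/
lemma fderiv_const_smul_real {F : Type*} [NormedAddCommGroup F] [NormedSpace ℝ F] (c : ℝ)
    (f : E → F) (y : E) : fderiv ℝ (c • f) y = c • fderiv ℝ f y := by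
  rcases eq_or_ne c 0 with rfl | hc
  · simp
  · have := invertibleOfNonzero hc
    exact fderiv_const_smul_of_invertible c

lemma divergence_smul (g : MetricField E M) (c : ℝ) (X : ∀ p : M, TangentSpace 𝓘(ℝ, E) p) (p : M) :
    divergence g (fun q => c • X q) p = c * divergence g X p := by
  have hf : chartField (fun q => c • X q) p = c • chartField X p := by
    funext y
    exact map_smul (mfderiv 𝓘(ℝ, E) 𝓘(ℝ, E) (chartAt E p) ((chartAt E p).symm y)) c _
  have hX : christoffel (chartMetric g p) (chartAt E p p) (c • X p : E) =
      c • christoffel (chartMetric g p) (chartAt E p p) (X p) := christoffel_smul _ _ _ _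
  have h : covDeriv g (fun q => c • X q) p = c • covDeriv g X p := by
    rw [covDeriv_eq, covDeriv_eq, hf, fderiv_const_smul_real]
    refine (congrArg (_ + ·) hX).trans ?_
    exact (smul_add c _ _).symm
  unfold divergence
  rw [h]
  exact map_smul (LinearMap.trace ℝ (TangentSpace 𝓘(ℝ, E) p)) c (covDeriv g X p).toLinearMap

lemma divergence_of_subsingleton [Subsingleton E] (g : MetricField E M)
    (X : ∀ p : M, TangentSpace 𝓘(ℝ, E) p) (p : M) : divergence g X p = 0 := by
  have : Subsingleton (TangentSpace 𝓘(ℝ, E) p) := inferInstanceAs (Subsingleton E)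
  unfold divergence
  rw [Subsingleton.elim (covDeriv g X p).toLinearMap 0, map_zero]

end Divergence

lemma two_le_infty : (2 : WithTop ℕ∞) ≤ ∞ :=
  WithTop.coe_le_coe.2 (le_top : (2 : ℕ∞) ≤ ⊤)

/-! ### Gauss' formula in charts -/

section ChartExpr

/-- The expression in the preferred charts at `p` and at `f p` of a map between manifolds. -/
def chartExpr (E F : Type*) [NormedAddCommGroup E] [NormedAddCommGroup F] {M N : Type*}
    [TopologicalSpace M] [ChartedSpace E M] [TopologicalSpace N] [ChartedSpace F N] (f : M → N)
    (p : M) (y : E) : F :=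
  chartAt F (f p) (f ((chartAt E p).symm y))

lemma chartExpr_self {E F : Type*} [NormedAddCommGroup E] [NormedAddCommGroup F] {M N : Type*}
    [TopologicalSpace M] [ChartedSpace E M] [TopologicalSpace N] [ChartedSpace F N]
    (f : M → N) (p : M) : chartExpr E F f p (chartAt E p p) = chartAt F (f p) (f p) := by
  simp [chartExpr]

lemma secondFundamentalForm_eq {E F : Type*} [NormedAddCommGroup E] [NormedSpace ℝ E]
    [NormedAddCommGroup F] [NormedSpace ℝ F] {M N : Type*}
    [TopologicalSpace M] [ChartedSpace E M] [TopologicalSpace N] [ChartedSpace F N]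
    (g : MetricField E M) (h : MetricField F N) (f : M → N) (p : M)
    (u v : E) : (secondFundamentalForm g h f p u v : F) =
      fderiv ℝ (fderiv ℝ (chartExpr E F f p)) (chartAt E p p) u v
      + christoffel (chartMetric h (f p)) (chartAt F (f p) (f p))
          (fderiv ℝ (chartExpr E F f p) (chartAt E p p) v)
          (fderiv ℝ (chartExpr E F f p) (chartAt E p p) u)
      - fderiv ℝ (chartExpr E F f p) (chartAt E p p)
          (christoffel (chartMetric g p) (chartAt E p p) v u) := rfl

end ChartExpr

section InducedMetric

variable {E : Type*} [NormedAddCommGroup E] [NormedSpace ℝ E]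
variable {M : Type*} [TopologicalSpace M] [ChartedSpace E M] [IsManifold 𝓘(ℝ, E) ∞ M]
variable {F : Type*} [NormedAddCommGroup F] [NormedSpace ℝ F]
variable {N : Type*} [TopologicalSpace N] [ChartedSpace F N] [IsManifold 𝓘(ℝ, F) ∞ N]
variable {V : Type*} [NormedAddCommGroup V] [NormedSpace ℝ V]

lemma contDiffAt_chartExpr {f : M → N} (hf : ContMDiff 𝓘(ℝ, E) 𝓘(ℝ, F) ∞ f) (p : M) :
    ContDiffAt ℝ ∞ (chartExpr E F f p) (chartAt E p p) := by
  refine contDiffAt_comp_chart_symm (k := fun q => chartAt F (f p) (f q)) (mem_chart_target E p) ?_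
  rw [chart_symm_chart]
  exact (contMDiffAt_of_mem_maximalAtlas (IsManifold.chart_mem_maximalAtlas (f p))
    (mem_chart_source F (f p))).comp p (hf p)

/-- Gauss' formula: for the metric induced on `N` by a map `k` to a vector space with a symmetric
bilinear form `B`, the second fundamental form of `f : M → N` is the tangential part of that of
`k ∘ f`. -/
lemma apply_mfderiv_secondFundamentalForm [FiniteDimensional ℝ F] (g : MetricField E M)
    {h : MetricField F N} {k : N → V} {B : V →L[ℝ] V →L[ℝ] ℝ} (hB : ∀ a b, B a b = B b a)
    (hk : ContMDiff 𝓘(ℝ, F) 𝓘(ℝ, V) ∞ k)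
    (hh : ∀ (z : N) (a b : TangentSpace 𝓘(ℝ, F) z), h z a b =
      B (mfderiv 𝓘(ℝ, F) 𝓘(ℝ, V) k z a) (mfderiv 𝓘(ℝ, F) 𝓘(ℝ, V) k z b))
    (hnd : ∀ (z : N) (a : TangentSpace 𝓘(ℝ, F) z), h z a = 0 → a = 0)
    {f : M → N} (hf : ContMDiff 𝓘(ℝ, E) 𝓘(ℝ, F) ∞ f) (p : M) (u v : E)
    (c : F) :
    B (mfderiv 𝓘(ℝ, F) 𝓘(ℝ, V) k (f p) (secondFundamentalForm g h f p u v))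
      (mfderiv 𝓘(ℝ, F) 𝓘(ℝ, V) k (f p) c) =
    B (fderiv ℝ (fderiv ℝ fun y => k (f ((chartAt E p).symm y))) (chartAt E p p) u v
        - fderiv ℝ (fun y => k (f ((chartAt E p).symm y))) (chartAt E p p)
          (christoffel (chartMetric g p) (chartAt E p p) v u))
      (mfderiv 𝓘(ℝ, F) 𝓘(ℝ, V) k (f p) c) := by
  have hM : IsManifold 𝓘(ℝ, E) 1 M := IsManifold.of_le (n := ∞) (by simp)
  have hN : IsManifold 𝓘(ℝ, F) 1 N := IsManifold.of_le (n := ∞) (by simp)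
  have hkd : MDifferentiable 𝓘(ℝ, F) 𝓘(ℝ, V) k := hk.mdifferentiable (by simp)
  set khat : F → V := fun x => k ((chartAt F (f p)).symm x) with hkhat
  set fhat : E → F := chartExpr E F f p with hfhat
  set y : E := chartAt E p p with hy
  set z : F := chartAt F (f p) (f p) with hz
  have hfy : fhat y = z := chartExpr_self f p
  have hfs : ContDiffAt ℝ 2 fhat y := (contDiffAt_chartExpr hf p).of_le two_le_infty
  have hks : ContDiffAt ℝ 2 khat z :=
    (contDiffAt_comp_chart_symm (mem_chart_target F (f p)) (hk _)).of_le two_le_infty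
  have hdk : ∀ a : F, mfderiv 𝓘(ℝ, F) 𝓘(ℝ, V) k (f p) a = fderiv ℝ khat z a := fun a =>
    (fderiv_comp_chart_symm_self (hkd _) a).symm
  have hcomp : (fun y => k (f ((chartAt E p).symm y))) =ᶠ[𝓝 y] fun y => khat (fhat y) := by
    have hc : ContinuousAt (fun y => f ((chartAt E p).symm y)) y := by
      refine ContinuousAt.comp (g := f) hf.continuous.continuousAt ?_
      exact (chartAt E p).continuousAt_symm (mem_chart_target E p)
    have hs : f ((chartAt E p).symm y) ∈ (chartAt F (f p)).source := by
      rw [hy, chart_symm_chart]; exact mem_chart_source F (f p)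
    filter_upwards [hc.preimage_mem_nhds ((chartAt F (f p)).open_source.mem_nhds hs)] with x hx
    simp only [hkhat, hfhat, chartExpr]
    rw [(chartAt F (f p)).left_inv hx]
  have hmet : chartMetric h (f p) =ᶠ[𝓝 z] pullbackForm khat fun _ => B := by
    filter_upwards [eventually_mem_chart_target (f p)] with x hx
    exact chartMetric_eq_pullbackForm hkd hh hx
  have hmz : chartMetric h (f p) z = pullbackForm khat (fun _ => B) z := hmet.self_of_nhds
  have hnd' : ∀ a : F, chartMetric h (f p) z a = 0 → a = 0 := by
    intro a ha
    refine hnd (f p) a ?_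
    ext b
    exact (chartMetric_self h (f p) a b).symm.trans (congrArg (fun A => A b) ha)
  -- As `h` is the pull-back of the constant form `B` by `khat`, its Christoffel symbols of the
  -- first kind are `B(D²khat, Dkhat)`. Tangentially, `D²khat` may thus be exchanged for the
  -- Christoffel term of `h`.
  have hG : ∀ a b : F, B (fderiv ℝ khat z (christoffel (chartMetric h (f p)) z b a))
      (fderiv ℝ khat z c) = B (fderiv ℝ (fderiv ℝ khat) z a b) (fderiv ℝ khat z c) := by
    intro a b
    have h1 := apply_christoffel hnd' a b c
    rw [hmet.koszul_eq, koszul_pullbackForm_const hks hB] at h1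
    rw [← h1, hmz, pullbackForm_apply]
  have h1 : fderiv ℝ (fun y => k (f ((chartAt E p).symm y))) y =
      (fderiv ℝ khat z).comp (fderiv ℝ fhat y) := by
    rw [hcomp.fderiv_eq]
    have := fderiv_comp y (g := khat) (by rw [hfy]; exact hks.differentiableAt (by norm_num))
      (hfs.differentiableAt (by norm_num))
    rwa [hfy] at this
  -- The term `D²khat(Dfhat u, Dfhat v)` of the second-order chain rule is the one that `hG` matches
  -- with the Christoffel term of `N`.
  have h2 := fderiv_fderiv_comp (Q := khat) (by rwa [hfy]) hfs u v
  rw [← hcomp.fderiv.fderiv_eq, hfy] at h2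
  have h3 := secondFundamentalForm_eq g h f p u v
  rw [← hfhat, ← hy, ← hz] at h3
  rw [h1, h2]
  refine (congrArg₂ (fun a b => B a b) ((hdk _).trans (congrArg _ h3)) (hdk c)).trans ?_
  refine Eq.trans ?_ (congrArg (fun b => B _ b) (hdk c)).symm
  have h4 := hG (fderiv ℝ fhat y u) (fderiv ℝ fhat y v)
  simp only [map_sub, map_add, sub_apply, add_apply, ContinuousLinearMap.comp_apply, h4]
  ring

end InducedMetric

/-! ### Real and Hermitian products on `ℂ^n` -/

section RealInner

variable {n : ℕ}

lemma realInner_comm (u v : CSpace n) : realInner n u v = realInner n v u := by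
  rw [realInner_apply, realInner_apply, ← inner_conj_symm, Complex.conj_re]

lemma realInner_self (u : CSpace n) : realInner n u u = ‖u‖ ^ 2 := by
  rw [realInner_apply, inner_self_eq_norm_sq_to_K]
  norm_cast

lemma realInner_smul_left (c : ℝ) (u v : CSpace n) :
    realInner n (c • u) v = c * realInner n u v := by
  rw [map_smul, smul_apply, smul_eq_mul]

lemma realInner_sum_left {ι : Type*} (s : Finset ι) (u : ι → CSpace n) (v : CSpace n) :
    realInner n (∑ i ∈ s, u i) v = ∑ i ∈ s, realInner n (u i) v := by
  rw [map_sum, sum_apply]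

lemma realInner_I_I (u v : CSpace n) :
    realInner n (Complex.I • u) (Complex.I • v) = realInner n u v := by
  simp [realInner_apply, ← mul_assoc]

lemma realInner_I_left (u v : CSpace n) :
    realInner n (Complex.I • u) v = -realInner n u (Complex.I • v) := by
  simp [realInner_apply]

lemma realInner_I_self (u : CSpace n) : realInner n u (Complex.I • u) = 0 := by
  have h1 := realInner_I_left u u
  rw [realInner_comm] at h1
  linarith

/-- The Hermitian product in terms of the real inner product. -/
lemma inner_eq_realInner (u v : CSpace n) :
    inner ℂ u v = (realInner n u v : ℂ) + (realInner n (Complex.I • u) v : ℂ) * Complex.I := by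
  apply Complex.ext <;> simp [realInner_apply]

variable {E : Type*} [NormedAddCommGroup E] [NormedSpace ℝ E]

lemma fderiv_I_smul {a : E → CSpace n} {y : E} (ha : DifferentiableAt ℝ a y) (u : E) :
    fderiv ℝ (fun x => Complex.I • a x) y u = Complex.I • fderiv ℝ a y u := by
  have h : HasFDerivAt (fun x => Complex.I • a x) (Complex.I • fderiv ℝ a y) y :=
    ha.hasFDerivAt.const_smul Complex.I
  rw [h.fderiv]
  rfl

/-- The Leibniz rule for a constant inner product. -/
lemma realInner_fderiv_of_eventually_const {a b : E → CSpace n} {y : E} {c : ℝ}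
    (ha : DifferentiableAt ℝ a y) (hb : DifferentiableAt ℝ b y)
    (h : ∀ᶠ x in 𝓝 y, realInner n (a x) (b x) = c) (u : E) :
    realInner n (fderiv ℝ a y u) (b y) + realInner n (a y) (fderiv ℝ b y u) = 0 := by
  have h1 := ((realInner n).hasFDerivAt.comp y ha.hasFDerivAt).clm_apply hb.hasFDerivAt
  have h2 : HasFDerivAt (fun x => realInner n (a x) (b x)) (0 : E →L[ℝ] ℝ) y :=
    (hasFDerivAt_const c y).congr_of_eventuallyEq h
  have h3 := congrArg (fun A => A u) (h1.unique h2)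
  simp only [ContinuousLinearMap.comp_apply, add_apply, zero_apply,
    ContinuousLinearMap.flip_apply, Function.comp_apply] at h3
  linarith

end RealInner

/-! ### Derivatives of a Legendrian map and the cubic form -/

section LocalLegendrian

variable {n : ℕ} {E : Type*} [NormedAddCommGroup E] [NormedSpace ℝ E]

/-- A smooth Legendrian map from an open subset of a vector space to the unit sphere of
`ℂ^{n+1}`. -/
structure IsLocalLegendrian (f : E → CSpace (n + 1)) (U : Set E) : Prop where
  isOpen : IsOpen U
  contDiffAt : ∀ y ∈ U, ContDiffAt ℝ 2 f y
  norm_eq_one : ∀ y ∈ U, ‖f y‖ = 1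
  legendrian : ∀ y ∈ U, ∀ u, realInner (n + 1) (fderiv ℝ f y u) (Complex.I • f y) = 0

namespace IsLocalLegendrian

variable {f : E → CSpace (n + 1)} {U : Set E} (hf : IsLocalLegendrian f U) {y : E} (hy : y ∈ U)
include hf hy

lemma eventually_mem : ∀ᶠ x in 𝓝 y, x ∈ U := hf.isOpen.mem_nhds hy

lemma differentiableAt : DifferentiableAt ℝ f y := (hf.contDiffAt y hy).differentiableAt (by simp)

lemma differentiableAt_fderiv : DifferentiableAt ℝ (fderiv ℝ f) y :=
  ((hf.contDiffAt y hy).fderiv_right (m := 1) (by norm_num)).differentiableAt (by norm_num)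

lemma differentiableAt_fderiv_apply (v : E) : DifferentiableAt ℝ (fun x => fderiv ℝ f x v) y :=
  (hf.differentiableAt_fderiv hy).clm_apply (differentiableAt_const v)

lemma fderiv_fderiv_apply (u v : E) :
    fderiv ℝ (fun x => fderiv ℝ f x v) y u = fderiv ℝ (fderiv ℝ f) y u v := by
  rw [((hf.differentiableAt_fderiv hy).hasFDerivAt.clm_apply (hasFDerivAt_const v y)).fderiv]
  simp

lemma symm (u v : E) : fderiv ℝ (fderiv ℝ f) y u v = fderiv ℝ (fderiv ℝ f) y v u :=
  (hf.contDiffAt y hy).isSymmSndFDerivAt (by simp) u v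

lemma realInner_fderiv_self (u : E) : realInner (n + 1) (fderiv ℝ f y u) (f y) = 0 := by
  have h := realInner_fderiv_of_eventually_const (hf.differentiableAt hy)
    (hf.differentiableAt hy) (c := 1) (by
      filter_upwards [hf.eventually_mem hy] with x hx
      rw [realInner_self, hf.norm_eq_one x hx, one_pow]) u
  rw [realInner_comm (f y)] at h
  linarith

lemma realInner_fderiv_fderiv_self (u v : E) :
    realInner (n + 1) (fderiv ℝ (fderiv ℝ f) y u v) (f y) =
      -realInner (n + 1) (fderiv ℝ f y u) (fderiv ℝ f y v) := by
  have h := realInner_fderiv_of_eventually_const (hf.differentiableAt_fderiv_apply hy v)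
    (hf.differentiableAt hy) (c := 0) (by
      filter_upwards [hf.eventually_mem hy] with x hx
      exact hf.realInner_fderiv_self hx v) u
  rw [hf.fderiv_fderiv_apply hy, realInner_comm (fderiv ℝ f y v)] at h
  linarith

/-- The derivative of the Legendrian condition `⟨df v, Jf⟩ = 0` in the direction `u`. -/
lemma realInner_fderiv_fderiv_I_add (u v : E) :
    realInner (n + 1) (fderiv ℝ (fderiv ℝ f) y u v) (Complex.I • f y) +
      realInner (n + 1) (fderiv ℝ f y v) (Complex.I • fderiv ℝ f y u) = 0 := by
  have h := realInner_fderiv_of_eventually_const (hf.differentiableAt_fderiv_apply hy v)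
    ((hf.differentiableAt hy).const_smul Complex.I) (c := 0) (by
      filter_upwards [hf.eventually_mem hy] with x hx
      exact hf.legendrian x hx v) u
  have h2 := fderiv_I_smul (hf.differentiableAt hy) u
  rw [hf.fderiv_fderiv_apply hy] at h
  rw [← h2]
  exact h

/-- In `realInner_fderiv_fderiv_I_add` the first term is symmetric in `u, v` because second
derivatives commute, while the second is skew because `J` is; hence each of them vanishes. -/
lemma lagrangian (u v : E) :
    realInner (n + 1) (fderiv ℝ f y u) (Complex.I • fderiv ℝ f y v) = 0 := by
  have h1 := hf.realInner_fderiv_fderiv_I_add hy v u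
  have h2 := hf.realInner_fderiv_fderiv_I_add hy u v
  rw [hf.symm hy] at h1
  have h3 := realInner_I_left (fderiv ℝ f y u) (fderiv ℝ f y v)
  rw [realInner_comm] at h3
  linarith

lemma realInner_fderiv_fderiv_I (u v : E) :
    realInner (n + 1) (fderiv ℝ (fderiv ℝ f) y u v) (Complex.I • f y) = 0 := by
  have h1 := hf.realInner_fderiv_fderiv_I_add hy u v
  rw [hf.lagrangian hy] at h1
  linarith

/-- The symmetry of the cubic form of a Lagrangian map. -/
lemma cubic_symm (u v w : E) :
    realInner (n + 1) (fderiv ℝ (fderiv ℝ f) y u v) (Complex.I • fderiv ℝ f y w) =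
      realInner (n + 1) (fderiv ℝ (fderiv ℝ f) y u w) (Complex.I • fderiv ℝ f y v) := by
  have h := realInner_fderiv_of_eventually_const (hf.differentiableAt_fderiv_apply hy v)
    ((hf.differentiableAt_fderiv_apply hy w).const_smul Complex.I) (c := 0) (by
      filter_upwards [hf.eventually_mem hy] with x hx
      exact hf.lagrangian hx v w) u
  have h2 := fderiv_I_smul (hf.differentiableAt_fderiv_apply hy w) u
  rw [hf.fderiv_fderiv_apply hy] at h h2
  have h3 : realInner (n + 1) (fderiv ℝ (fderiv ℝ f) y u v) (Complex.I • fderiv ℝ f y w) +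
      realInner (n + 1) (fderiv ℝ f y v) (Complex.I • fderiv ℝ (fderiv ℝ f) y u w) = 0 := by
    rw [← h2]; exact h
  have h4 := realInner_I_left (fderiv ℝ f y v) (fderiv ℝ (fderiv ℝ f) y u w)
  rw [realInner_comm] at h4
  linarith

end IsLocalLegendrian

end LocalLegendrian

/-! ### Unitary frames -/

section Frames

variable {n : ℕ}

/-- Vectors which span, together with `z`, a real subspace on which the Hermitian product is real,
and which are orthonormal, form a unitary basis. -/
lemma orthonormal_cons {z : CSpace (n + 1)} {v : Fin n → CSpace (n + 1)} (hz : ‖z‖ = 1)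
    (hvz : ∀ i, realInner (n + 1) (v i) z = 0)
    (hvJz : ∀ i, realInner (n + 1) (v i) (Complex.I • z) = 0)
    (hv : ∀ i j, realInner (n + 1) (v i) (v j) = if i = j then 1 else 0)
    (hvJ : ∀ i j, realInner (n + 1) (v i) (Complex.I • v j) = 0) :
    Orthonormal ℂ (Fin.cons z v : Fin (n + 1) → CSpace (n + 1)) := by
  rw [orthonormal_iff_ite]
  intro i j
  refine Fin.cases ?_ (fun i => ?_) i <;> refine Fin.cases ?_ (fun j => ?_) j
  · simp [inner_self_eq_norm_sq_to_K, hz]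
  · simp only [Fin.cons_zero, Fin.cons_succ, (Fin.succ_ne_zero j).symm, if_false]
    rw [inner_eq_realInner, realInner_comm, hvz, realInner_comm, hvJz]
    simp
  · simp only [Fin.cons_zero, Fin.cons_succ, Fin.succ_ne_zero i, if_false]
    rw [inner_eq_realInner, hvz, realInner_I_left, hvJz]
    simp
  · simp only [Fin.cons_succ, Fin.succ_inj]
    rw [inner_eq_realInner, hv, realInner_I_left, hvJ]
    split_ifs <;> simp

/-- The unitary basis given by `n + 1` orthonormal vectors of `ℂ^{n+1}`. -/
lemma exists_orthonormalBasis_of_orthonormal {a : Fin (n + 1) → CSpace (n + 1)}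
    (ha : Orthonormal ℂ a) : ∃ b : OrthonormalBasis (Fin (n + 1)) ℂ (CSpace (n + 1)), ⇑b = a := by
  have hcard : Fintype.card (Fin (n + 1)) = finrank ℂ (CSpace (n + 1)) := by simp
  have hb := coe_basisOfOrthonormalOfCardEqFinrank ha hcard
  refine ⟨(basisOfOrthonormalOfCardEqFinrank ha hcard).toOrthonormalBasis (by rwa [hb]), ?_⟩
  rw [Basis.coe_toOrthonormalBasis, hb]

lemma norm_complexVolume {z : CSpace (n + 1)} {v : Fin n → CSpace (n + 1)}
    (h : Orthonormal ℂ (Fin.cons z v : Fin (n + 1) → CSpace (n + 1))) :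
    ‖complexVolume z v‖ = 1 := by
  unfold complexVolume
  set A : Matrix (Fin (n + 1)) (Fin (n + 1)) ℂ :=
    Matrix.of fun i k => (Fin.cons z v : Fin (n + 1) → CSpace (n + 1)) i k with hA
  have hU : A ∈ Matrix.unitaryGroup (Fin (n + 1)) ℂ := by
    rw [Matrix.mem_unitaryGroup_iff]
    ext i j
    -- The Hermitian product is conjugate linear in its first argument, so the `(i, j)` entry of `A
    -- A*` is the product of row `j` with row `i`.
    have := (orthonormal_iff_ite.1 h) j i
    rw [Matrix.mul_apply, Matrix.one_apply]
    simp only [PiLp.inner_apply, RCLike.inner_apply] at this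
    simp only [hA, Matrix.star_apply, Matrix.of_apply]
    simp only [eq_comm (a := i)]
    exact this
  have := Matrix.det_of_mem_unitary hU
  exact CStarRing.norm_of_mem_unitary this

end Frames

/-! ### The unit sphere as a submanifold of `ℂ^{n+1}` -/

section Sphere

variable {n : ℕ}

instance isManifold_oddSphere : IsManifold 𝓘(ℝ, RSpace (2 * n + 1)) ∞ (OddSphere n) :=
  IsManifold.of_le (n := ω) le_top

lemma contMDiff_oddSphere_coe :
    ContMDiff 𝓘(ℝ, RSpace (2 * n + 1)) 𝓘(ℝ, CSpace (n + 1)) ∞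
      ((↑) : OddSphere n → CSpace (n + 1)) :=
  contMDiff_coe_sphere

lemma sphereIncl_injective (z : OddSphere n) : Function.Injective (sphereIncl z) :=
  by
  have h := injective_mvfderiv_subtypeVal_sphere (n := 2 * n + 1) z
  exact h

lemma mem_range_sphereIncl (z : OddSphere n) (a : CSpace (n + 1)) :
    (∃ b, sphereIncl z b = a) ↔ realInner (n + 1) (z : CSpace (n + 1)) a = 0 := by
  have h : (sphereIncl z).range = (ℝ ∙ (z : CSpace (n + 1)))ᗮ := range_mvfderiv_subtypeVal z
  have h2 : a ∈ (sphereIncl z).range ↔ a ∈ (ℝ ∙ (z : CSpace (n + 1)))ᗮ := by rw [h]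
  rw [Submodule.mem_orthogonal_singleton_iff_inner_right] at h2
  exact h2

lemma roundMetric_nondegenerate (z : OddSphere n) (a : TangentSpace 𝓘(ℝ, RSpace (2 * n + 1)) z)
    (h : roundMetric n z a = 0) : a = 0 := by
  have h1 : realInner (n + 1) (sphereIncl z a) (sphereIncl z a) = 0 := congrArg (fun A => A a) h
  rw [realInner_self, sq_eq_zero_iff, norm_eq_zero] at h1
  exact (map_eq_zero_iff (sphereIncl z) (sphereIncl_injective z)).1 h1

end Sphere

/-! ### Second-order geometry of a Legendrian immersion -/

section Legendrian

variable {n : ℕ} {M : Type*} [TopologicalSpace M] [ChartedSpace (RSpace n) M]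

/-- The expression of `φ` in the preferred chart at `p`, with values in `ℂ^{n+1}`. -/
def localLift (φ : M → OddSphere n) (p : M) (y : RSpace n) : CSpace (n + 1) :=
  (φ ((chartAt (RSpace n) p).symm y) : CSpace (n + 1))

lemma localLift_self (φ : M → OddSphere n) (p : M) :
    localLift φ p (chartAt (RSpace n) p p) = φ p := by
  simp [localLift]

/-- The derivative of `localLift φ p` at the point `p`. -/
def coordDeriv (φ : M → OddSphere n) (p : M) : RSpace n →L[ℝ] CSpace (n + 1) :=
  fderiv ℝ (localLift φ p) (chartAt (RSpace n) p p)

/-- The second derivative of `localLift φ p` at the point `p`. -/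
def coordHess (φ : M → OddSphere n) (p : M) : RSpace n →L[ℝ] RSpace n →L[ℝ] CSpace (n + 1) :=
  fderiv ℝ (fderiv ℝ (localLift φ p)) (chartAt (RSpace n) p p)

/-- The bilinear form `g p` as a form on the model space. -/
def coordMetric (g : MetricField (RSpace n) M) (p : M) : RSpace n →L[ℝ] RSpace n →L[ℝ] ℝ := g p

/-- The Christoffel symbols of `g` at `p`. -/
def coordChristoffel (g : MetricField (RSpace n) M) (p : M) (v u : RSpace n) : RSpace n :=
  christoffel (chartMetric g p) (chartAt (RSpace n) p p) v u

namespace IsLegendrianImmersion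

variable {g : MetricField (RSpace n) M} {φ : M → OddSphere n} (hφ : IsLegendrianImmersion g φ)
include hφ

lemma contMDiff_coe :
    ContMDiff 𝓘(ℝ, RSpace n) 𝓘(ℝ, CSpace (n + 1)) ∞ (fun q => (φ q : CSpace (n + 1))) :=
  contMDiff_oddSphere_coe.comp hφ.contMDiff

lemma mdifferentiable_coe :
    MDifferentiable 𝓘(ℝ, RSpace n) 𝓘(ℝ, CSpace (n + 1)) (fun q => (φ q : CSpace (n + 1))) :=
  hφ.contMDiff_coe.mdifferentiable (by simp)

lemma mfderiv_coe (q : M) :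
    mfderiv 𝓘(ℝ, RSpace n) 𝓘(ℝ, CSpace (n + 1)) (fun q => (φ q : CSpace (n + 1))) q =
      sphereDeriv φ q :=
  mfderiv_comp q (contMDiff_oddSphere_coe.mdifferentiable (by simp) _)
    (hφ.contMDiff.mdifferentiable (by simp) q)

lemma metric_apply (p : M) (u v : TangentSpace 𝓘(ℝ, RSpace n) p) :
    g p u v = realInner (n + 1) (sphereDeriv φ p u) (sphereDeriv φ p v) :=
  (hφ.isometric p u v).symm

lemma sphereDeriv_injective (p : M) : Function.Injective (sphereDeriv φ p) :=
  (sphereIncl_injective _).comp (hφ.injective p)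

lemma metric_nondegenerate (p : M) (u : TangentSpace 𝓘(ℝ, RSpace n) p) (h : g p u = 0) :
    u = 0 := by
  have h1 : g p u u = 0 := congrArg (fun A => A u) h
  rw [hφ.metric_apply, realInner_self, sq_eq_zero_iff, norm_eq_zero] at h1
  exact (map_eq_zero_iff (sphereDeriv φ p) (hφ.sphereDeriv_injective p)).1 h1

lemma coordMetric_nondegenerate (p : M) (u : RSpace n) (h : coordMetric g p u = 0) : u = 0 :=
  hφ.metric_nondegenerate p u h

variable [IsManifold 𝓘(ℝ, RSpace n) ∞ M]

lemma fderiv_localLift {p : M} {y : RSpace n} (hy : y ∈ (chartAt (RSpace n) p).target)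
    (u : RSpace n) : fderiv ℝ (localLift φ p) y u =
      sphereDeriv φ ((chartAt (RSpace n) p).symm y) (chartSymmDeriv p y u) := by
  have : IsManifold 𝓘(ℝ, RSpace n) 1 M := IsManifold.of_le (n := ∞) (by simp)
  rw [← hφ.mfderiv_coe]
  exact fderiv_comp_chart_symm hy (hφ.mdifferentiable_coe _) u

lemma coordDeriv_eq (p : M) : coordDeriv φ p = (sphereDeriv φ p : RSpace n →L[ℝ] _) := by
  have : IsManifold 𝓘(ℝ, RSpace n) 1 M := IsManifold.of_le (n := ∞) (by simp)
  ext1 u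
  rw [← hφ.mfderiv_coe]
  exact fderiv_comp_chart_symm_self (hφ.mdifferentiable_coe _) u

lemma coordMetric_apply (p : M) (u v : RSpace n) :
    coordMetric g p u v = realInner (n + 1) (coordDeriv φ p u) (coordDeriv φ p v) := by
  rw [hφ.coordDeriv_eq]
  exact hφ.metric_apply p u v

lemma coordDeriv_injective (p : M) : Function.Injective (coordDeriv φ p) := by
  rw [hφ.coordDeriv_eq]
  exact hφ.sphereDeriv_injective p

lemma isLocalLegendrian (p : M) :
    IsLocalLegendrian (localLift φ p) (chartAt (RSpace n) p).target where
  isOpen := (chartAt (RSpace n) p).open_target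
  contDiffAt y hy :=
    (contDiffAt_comp_chart_symm hy (hφ.contMDiff_coe _)).of_le two_le_infty
  norm_eq_one y _ := by simp [localLift]
  legendrian y hy u := by
    rw [hφ.fderiv_localLift hy]
    exact hφ.legendrian _ _

lemma chartMetric_eventuallyEq (p : M) :
    chartMetric g p =ᶠ[𝓝 (chartAt (RSpace n) p p)]
      pullbackForm (localLift φ p) fun _ => realInner (n + 1) := by
  have : IsManifold 𝓘(ℝ, RSpace n) 1 M := IsManifold.of_le (n := ∞) (by simp)
  filter_upwards [eventually_mem_chart_target p] with x hx
  refine chartMetric_eq_pullbackForm hφ.mdifferentiable_coe ?_ hx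
  intro p u v
  rw [hφ.mfderiv_coe]
  exact hφ.metric_apply p u v

lemma realInner_coordDeriv_self (p : M) (u : RSpace n) :
    realInner (n + 1) (coordDeriv φ p u) (φ p) = 0 := by
  rw [← localLift_self φ p]
  exact (hφ.isLocalLegendrian p).realInner_fderiv_self (mem_chart_target _ p) u

lemma realInner_coordDeriv_I_self (p : M) (u : RSpace n) :
    realInner (n + 1) (coordDeriv φ p u) (Complex.I • (φ p : CSpace (n + 1))) = 0 := by
  rw [← localLift_self φ p]
  exact (hφ.isLocalLegendrian p).legendrian _ (mem_chart_target _ p) u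

lemma realInner_coordDeriv_I (p : M) (u v : RSpace n) :
    realInner (n + 1) (coordDeriv φ p u) (Complex.I • coordDeriv φ p v) = 0 :=
  (hφ.isLocalLegendrian p).lagrangian (mem_chart_target _ p) u v

lemma realInner_coordHess_self (p : M) (u v : RSpace n) :
    realInner (n + 1) (coordHess φ p u v) (φ p) = -coordMetric g p u v := by
  rw [← localLift_self φ p, hφ.coordMetric_apply]
  exact (hφ.isLocalLegendrian p).realInner_fderiv_fderiv_self (mem_chart_target _ p) u v

lemma realInner_coordHess_I_self (p : M) (u v : RSpace n) :
    realInner (n + 1) (coordHess φ p u v) (Complex.I • (φ p : CSpace (n + 1))) = 0 := by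
  rw [← localLift_self φ p]
  exact (hφ.isLocalLegendrian p).realInner_fderiv_fderiv_I (mem_chart_target _ p) u v

/-- `D²f - Df Γ` is normal to the immersion. -/
lemma realInner_coordHess_sub (p : M) (u v w : RSpace n) :
    realInner (n + 1) (coordHess φ p u v - coordDeriv φ p (coordChristoffel g p v u))
      (coordDeriv φ p w) = 0 := by
  have : IsManifold 𝓘(ℝ, RSpace n) 1 M := IsManifold.of_le (n := ∞) (by simp)
  have hself : chartMetric g p (chartAt (RSpace n) p p) = coordMetric g p := by
    ext a b
    exact chartMetric_self g p a b
  have h1 := apply_christoffel (G := chartMetric g p) (y := chartAt (RSpace n) p p)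
    (by rw [hself]; exact hφ.coordMetric_nondegenerate p) u v w
  rw [(hφ.chartMetric_eventuallyEq p).koszul_eq,
    koszul_pullbackForm_const ((hφ.isLocalLegendrian p).contDiffAt _ (mem_chart_target _ p))
      realInner_comm, hself, hφ.coordMetric_apply] at h1
  rw [map_sub, sub_apply]
  exact sub_eq_zero.2 h1.symm

/-- The component of `D²f - df Γ` along the position vector is `-g(u, v)`, since `⟨D²f(u,v), f⟩ =
-⟨df u, df v⟩`; adding `g(u, v) φ` projects onto the tangent space of the sphere, where Gauss'
formula determines the second fundamental form. -/
lemma sphereIncl_secondFundamentalForm (p : M) (u v : RSpace n) :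
    sphereIncl (φ p) (secondFundamentalForm g (roundMetric n) φ p u v) =
      coordHess φ p u v - coordDeriv φ p (coordChristoffel g p v u)
        + coordMetric g p u v • (φ p : CSpace (n + 1)) := by
  set S : CSpace (n + 1) := coordHess φ p u v - coordDeriv φ p (coordChristoffel g p v u) with hS
  set s := secondFundamentalForm g (roundMetric n) φ p u v with hs
  have hnorm : realInner (n + 1) (φ p : CSpace (n + 1)) (φ p) = 1 := by
    simp [realInner_self]
  have h0 : realInner (n + 1) (φ p : CSpace (n + 1))
      (S + coordMetric g p u v • (φ p : CSpace (n + 1))) = 0 := by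
    rw [realInner_comm, hS, map_add, map_sub, map_smul, add_apply, sub_apply, smul_apply, hnorm,
      hφ.realInner_coordDeriv_self, hφ.realInner_coordHess_self]
    simp
  obtain ⟨t, ht⟩ := (mem_range_sphereIncl (φ p) _).2 h0
  -- The candidate `t` and the actual value `s` have the same products with every vector tangent to
  -- the sphere; applied to `s - t` itself, this gives equality.
  have hperp : ∀ c, realInner (n + 1) (sphereIncl (φ p) (s - t)) (sphereIncl (φ p) c) = 0 := by
    intro c
    have h1 : realInner (n + 1) (sphereIncl (φ p) s) (sphereIncl (φ p) c) =
        realInner (n + 1) S (sphereIncl (φ p) c) :=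
      apply_mfderiv_secondFundamentalForm g (h := roundMetric n)
        (k := ((↑) : OddSphere n → CSpace (n + 1))) realInner_comm contMDiff_oddSphere_coe
        (fun _ _ _ => rfl) roundMetric_nondegenerate hφ.contMDiff p u v c
    have h2 : realInner (n + 1) (φ p : CSpace (n + 1)) (sphereIncl (φ p) c) = 0 :=
      (mem_range_sphereIncl (φ p) _).1 ⟨c, rfl⟩
    rw [map_sub, map_sub, sub_apply, h1, ht, map_add, map_smul, add_apply, smul_apply, h2]
    simp
  have h4 := hperp (s - t)
  rw [realInner_self, sq_eq_zero_iff, norm_eq_zero, map_sub, ht] at h4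
  exact sub_eq_zero.1 h4

end IsLegendrianImmersion

end Legendrian

/-! ### The mean curvature vector and the tangent field `JH` -/

section MeanCurvature

variable {n : ℕ} {M : Type*} [TopologicalSpace M] [ChartedSpace (RSpace n) M]

/-- The vectors `(bⁱ)♯` dual to the standard basis `finBasis` for the metric at `p`. -/
def dualVec (g : MetricField (RSpace n) M) (p : M) (i : Fin (finrank ℝ (RSpace n))) : RSpace n :=
  (coordMetric g p).inverse ((finBasis ℝ (RSpace n)).coord i).toContinuousLinearMap

/-- The mean curvature vector of `φ`, as a vector of `ℂ^{n+1}`. -/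
def meanVec (g : MetricField (RSpace n) M) (φ : M → OddSphere n) (p : M) : CSpace (n + 1) :=
  sphereIncl (φ p) (meanCurvature g (roundMetric n) φ p)

lemma realInner_meanVec_self (g : MetricField (RSpace n) M) (φ : M → OddSphere n) (p : M) :
    realInner (n + 1) (φ p : CSpace (n + 1)) (meanVec g φ p) = 0 :=
  (mem_range_sphereIncl (φ p) _).1 ⟨_, rfl⟩

namespace IsLegendrianImmersion

variable [IsManifold 𝓘(ℝ, RSpace n) ∞ M]
variable {g : MetricField (RSpace n) M} {φ : M → OddSphere n} (hφ : IsLegendrianImmersion g φ)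
include hφ

lemma meanVec_eq (p : M) : meanVec g φ p = (1 / n : ℝ) • ∑ i,
    (coordHess φ p (finBasis ℝ (RSpace n) i) (dualVec g p i)
      - coordDeriv φ p (coordChristoffel g p (dualVec g p i) (finBasis ℝ (RSpace n) i))
      + coordMetric g p (finBasis ℝ (RSpace n) i) (dualVec g p i) • (φ p : CSpace (n + 1))) := by
  have h : meanCurvature g (roundMetric n) φ p = (1 / n : ℝ) • ∑ i,
      secondFundamentalForm g (roundMetric n) φ p (finBasis ℝ (RSpace n) i) (dualVec g p i) := by
    have hn : (finrank ℝ (RSpace n) : ℝ) = n := by simp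
    rw [← hn]
    rfl
  rw [meanVec, h, map_smul, map_sum]
  congr 1
  exact Finset.sum_congr rfl fun i _ => hφ.sphereIncl_secondFundamentalForm p _ _

/-- An orthonormal basis of the image of the differential, in the Euclidean product, pulls back to a
`g`-orthonormal one because the immersion is isometric. -/
lemma exists_frame (p : M) : ∃ e : Basis (Fin n) ℝ (RSpace n),
    ∀ i j, coordMetric g p (e i) (e j) = if i = j then 1 else 0 := by
  let L := LinearEquiv.ofInjective (coordDeriv φ p).toLinearMap (hφ.coordDeriv_injective p)
  have hfin : finrank ℝ (LinearMap.range (coordDeriv φ p).toLinearMap) = n := by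
    rw [← L.finrank_eq]; simp
  let o := (stdOrthonormalBasis ℝ (LinearMap.range (coordDeriv φ p).toLinearMap)).reindex
    (finCongr hfin)
  refine ⟨o.toBasis.map L.symm, fun i j => ?_⟩
  have hL : ∀ x, coordDeriv φ p (L.symm x) = x := fun x =>
    congrArg Subtype.val (L.apply_symm_apply x)
  rw [hφ.coordMetric_apply, Basis.map_apply, Basis.map_apply, hL, hL]
  exact (orthonormal_iff_ite.1 o.orthonormal) i j

lemma orthonormal_frame {p : M} {e : Fin n → RSpace n}
    (he : ∀ i j, coordMetric g p (e i) (e j) = if i = j then 1 else 0) :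
    Orthonormal ℂ (Fin.cons (φ p : CSpace (n + 1)) (fun i => coordDeriv φ p (e i)) :
      Fin (n + 1) → CSpace (n + 1)) :=
  orthonormal_cons (by simp) (fun i => hφ.realInner_coordDeriv_self p _)
    (fun i => hφ.realInner_coordDeriv_I_self p _)
    (fun i j => by rw [← hφ.coordMetric_apply, he])
    (fun i j => hφ.realInner_coordDeriv_I p _ _)

lemma realInner_meanVec_coordDeriv (p : M) (w : RSpace n) :
    realInner (n + 1) (meanVec g φ p) (coordDeriv φ p w) = 0 := by
  rw [hφ.meanVec_eq, realInner_smul_left, realInner_sum_left]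
  refine mul_eq_zero_of_right _ (Finset.sum_eq_zero fun i _ => ?_)
  rw [map_add, add_apply, hφ.realInner_coordHess_sub, realInner_smul_left, realInner_comm,
    hφ.realInner_coordDeriv_self]
  simp

/-- `D²f`, `df` and `f` are all orthogonal to `Jf`. This is what keeps `JH` orthogonal to `φ`, and
so makes it tangent to the immersion and not only normal to `J` of its tangent space. -/
lemma realInner_meanVec_I_self (p : M) :
    realInner (n + 1) (meanVec g φ p) (Complex.I • (φ p : CSpace (n + 1))) = 0 := by
  rw [hφ.meanVec_eq, realInner_smul_left, realInner_sum_left]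
  refine mul_eq_zero_of_right _ (Finset.sum_eq_zero fun i _ => ?_)
  rw [map_add, map_sub, add_apply, sub_apply, hφ.realInner_coordHess_I_self,
    hφ.realInner_coordDeriv_I_self, realInner_smul_left, realInner_I_self]
  simp

/-- Against `J df(w)` the Christoffel term drops out by the Lagrangian property and the position
term by the Legendrian one. Only the trace of the cubic form is left, and it may be taken in any
orthonormal frame. -/
lemma realInner_meanVec_I (p : M) {e : Basis (Fin n) ℝ (RSpace n)}
    (he : ∀ i j, coordMetric g p (e i) (e j) = if i = j then 1 else 0) (w : RSpace n) :
    realInner (n + 1) (meanVec g φ p) (Complex.I • coordDeriv φ p w) =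
      (1 / n) * ∑ k, realInner (n + 1) (coordHess φ p (e k) (e k))
        (Complex.I • coordDeriv φ p w) := by
  let B : RSpace n →ₗ[ℝ] RSpace n →ₗ[ℝ] ℝ := LinearMap.mk₂ ℝ
    (fun u v => realInner (n + 1) (coordHess φ p u v) (Complex.I • coordDeriv φ p w))
    (by simp) (by simp) (by simp) (by simp)
  have h := sum_dual_eq_sum_orthonormal (hφ.coordMetric_nondegenerate p)
    (finBasis ℝ (RSpace n)) e he B
  have h2 : ∑ k, realInner (n + 1) (coordHess φ p (e k) (e k)) (Complex.I • coordDeriv φ p w) =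
    ∑ i, realInner (n + 1) (coordHess φ p (finBasis ℝ (RSpace n) i) (dualVec g p i))
      (Complex.I • coordDeriv φ p w) := h.symm
  rw [h2, hφ.meanVec_eq, realInner_smul_left, realInner_sum_left]
  congr 1
  refine Finset.sum_congr rfl fun i _ => ?_
  have h3 := realInner_I_left (φ p : CSpace (n + 1)) (coordDeriv φ p w)
  rw [realInner_comm, hφ.realInner_coordDeriv_I_self] at h3
  rw [map_add, map_sub, add_apply, sub_apply, hφ.realInner_coordDeriv_I, realInner_smul_left]
  linear_combination coordMetric g p (finBasis ℝ (RSpace n) i) (dualVec g p i) * h3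

/-- A vector orthogonal to `φ`, `Jφ` and `J φ_* (T_p M)` is tangent to `φ`. -/
lemma exists_coordDeriv_eq (p : M) {a : CSpace (n + 1)}
    (h1 : realInner (n + 1) (φ p : CSpace (n + 1)) a = 0)
    (h2 : realInner (n + 1) (Complex.I • (φ p : CSpace (n + 1))) a = 0)
    (h3 : ∀ w, realInner (n + 1) (Complex.I • coordDeriv φ p w) a = 0) :
    ∃ x, coordDeriv φ p x = a := by
  obtain ⟨e, he⟩ := hφ.exists_frame p
  obtain ⟨b, hb⟩ := exists_orthonormalBasis_of_orthonormal (hφ.orthonormal_frame he)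
  refine ⟨∑ i, realInner (n + 1) (coordDeriv φ p (e i)) a • e i, ?_⟩
  conv_rhs => rw [← b.sum_repr' a, hb, Fin.sum_univ_succ]
  simp only [Fin.cons_zero, Fin.cons_succ]
  rw [inner_eq_realInner, h1, h2, map_sum]
  simp only [Complex.ofReal_zero, zero_mul, add_zero, zero_smul, zero_add, map_smul]
  refine Finset.sum_congr rfl fun i _ => ?_
  rw [inner_eq_realInner, h3]
  simp

/-- `JH` is orthogonal to `φ`, `Jφ` and `J df` because `H` is orthogonal to `Jφ`, `φ` and `df`
respectively. -/
lemma exists_coordDeriv_eq_I_meanVec (p : M) :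
    ∃ x, coordDeriv φ p x = Complex.I • meanVec g φ p := by
  refine hφ.exists_coordDeriv_eq p ?_ ?_ fun w => ?_
  · have h := realInner_I_left (meanVec g φ p) (φ p : CSpace (n + 1))
    rw [realInner_comm, hφ.realInner_meanVec_I_self] at h
    simpa using h
  · rw [realInner_I_I, realInner_meanVec_self]
  · rw [realInner_I_I, realInner_comm, hφ.realInner_meanVec_coordDeriv]

/-- The metric product of the vector field `JH` on `M` with a tangent vector. -/
lemma coordMetric_of_coordDeriv_eq (p : M) {x : RSpace n}
    (hx : coordDeriv φ p x = Complex.I • meanVec g φ p) {e : Basis (Fin n) ℝ (RSpace n)}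
    (he : ∀ i j, coordMetric g p (e i) (e j) = if i = j then 1 else 0) (w : RSpace n) :
    coordMetric g p x w = -((1 / n) * ∑ k, realInner (n + 1) (coordHess φ p (e k) (e k))
        (Complex.I • coordDeriv φ p w)) := by
  rw [hφ.coordMetric_apply, hx, realInner_I_left, hφ.realInner_meanVec_I p he]

end IsLegendrianImmersion

end MeanCurvature

/-! ### The complex determinant and its derivative -/

section ComplexVolume

variable {n : ℕ}

/-- The determinant of `n + 1` vectors of `ℂ^{n+1}`, as a continuous alternating real map. -/
def volumeForm (n : ℕ) : CSpace (n + 1) [⋀^Fin (n + 1)]→L[ℝ] ℂ :=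
  ContinuousAlternatingMap.restrictScalars ℝ
    { (Matrix.detRowAlternating (R := ℂ) (n := Fin (n + 1))).compLinearMap
        (WithLp.linearEquiv 2 ℂ (Fin (n + 1) → ℂ)).toLinearMap with
      cont := by
        refine Continuous.matrix_det (A := fun v : Fin (n + 1) → CSpace (n + 1) =>
          Matrix.of fun i k => v i k) ?_
        exact continuous_matrix fun i k => by
          change Continuous fun v : Fin (n + 1) → CSpace (n + 1) => v i k
          fun_prop }

lemma volumeForm_update_smul (v : Fin (n + 1) → CSpace (n + 1)) (i : Fin (n + 1)) (c : ℂ)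
    (x : CSpace (n + 1)) :
    volumeForm n (Function.update v i (c • x)) = c * volumeForm n (Function.update v i x) :=
  ((Matrix.detRowAlternating (R := ℂ) (n := Fin (n + 1))).compLinearMap
        (WithLp.linearEquiv 2 ℂ (Fin (n + 1) → ℂ)).toLinearMap).map_update_smul v i c x

/-- Replacing a vector of a unitary basis multiplies the volume by the corresponding
coordinate. -/
lemma volumeForm_update (b : OrthonormalBasis (Fin (n + 1)) ℂ (CSpace (n + 1)))
    (i : Fin (n + 1)) (x : CSpace (n + 1)) :
    volumeForm n (Function.update b i x) = inner ℂ (b i) x * volumeForm n b := by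
  conv_lhs => rw [← b.sum_repr' x]
  rw [show volumeForm n (Function.update b i (∑ k, inner ℂ (b k) x • b k)) =
      ∑ k, volumeForm n (Function.update b i (inner ℂ (b k) x • b k)) from
    (volumeForm n).toAlternatingMap.map_update_sum _ _ _ _, Finset.sum_eq_single i]
  · rw [volumeForm_update_smul, Function.update_eq_self]
  · intro k _ hk
    rw [volumeForm_update_smul,
      (volumeForm n).map_eq_zero_of_eq _ (i := i) (j := k) (by simp [hk]) hk.symm, mul_zero]
  · simp

/-- The logarithmic derivative of a determinant, at a unitary basis. -/
lemma hasFDerivAt_volumeForm {E : Type*} [NormedAddCommGroup E] [NormedSpace ℝ E]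
    {a : Fin (n + 1) → E → CSpace (n + 1)} {a' : Fin (n + 1) → E →L[ℝ] CSpace (n + 1)} {y : E}
    (ha : ∀ i, HasFDerivAt (a i) (a' i) y) (h : Orthonormal ℂ fun i => a i y) :
    ∃ D : E →L[ℝ] ℂ, HasFDerivAt (fun x => volumeForm n fun i => a i x) D y ∧
      ∀ w, D w = (∑ i, inner ℂ (a i y) (a' i w)) * volumeForm n fun i => a i y := by
  obtain ⟨b, hb⟩ := exists_orthonormalBasis_of_orthonormal h
  refine ⟨_, HasFDerivAt.multilinear_comp (volumeForm n).toContinuousMultilinearMap ha, ?_⟩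
  intro w
  rw [sum_apply, Finset.sum_mul]
  refine Finset.sum_congr rfl fun i _ => ?_
  have h1 := volumeForm_update b i (a' i w)
  rw [hb] at h1
  exact h1

/-- The volume of the image of a family of `n` vectors, in terms of that of a basis. -/
lemma complexVolume_map {E : Type*} [AddCommGroup E] [Module ℝ E] (z : CSpace (n + 1))
    (A : E →ₗ[ℝ] CSpace (n + 1)) (e : Basis (Fin n) ℝ E) (v : Fin n → E) :
    complexVolume z (fun i => A (v i)) = (e.det v : ℂ) * complexVolume z (fun i => A (e i)) := by
  let F : E [⋀^Fin n]→ₗ[ℝ] ℂ :=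
    ((volumeForm n).toAlternatingMap.curryLeft z).compLinearMap A
  have hF : ∀ w, F w = complexVolume z (fun i => A (w i)) := fun w => rfl
  -- On an `n`-dimensional real space every real alternating `n`-form is a multiple of `e.det`; the
  -- real and imaginary parts of `F` are two such forms.
  have hre := congrArg (fun f => f v) ((Complex.reLm.compAlternatingMap F).eq_smul_basis_det e)
  have him := congrArg (fun f => f v) ((Complex.imLm.compAlternatingMap F).eq_smul_basis_det e)
  simp only [LinearMap.compAlternatingMap_apply, AlternatingMap.smul_apply, smul_eq_mul,
    Complex.reLm_coe, Complex.imLm_coe] at hre him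
  rw [← hF, ← hF]
  apply Complex.ext
  · rw [hre, Complex.re_ofReal_mul]
    ring
  · rw [him, Complex.im_ofReal_mul]
    ring

end ComplexVolume

/-! ### Differentiating an argument -/

section ArgumentDerivative

variable {E : Type*} [NormedAddCommGroup E] [NormedSpace ℝ E]

/-- The derivative of the argument of a complex function. -/
lemma hasFDerivAt_angle {D : E → ℂ} {D' : E →L[ℝ] ℂ} {b : E → ℝ} {b' : E →L[ℝ] ℝ} {y : E}
    (hD : HasFDerivAt D D' y) (hb : HasFDerivAt b b' y) (hne : D y ≠ 0)
    (h : ∀ᶠ x in 𝓝 y, ∃ r : ℝ, D x = r * Complex.exp (b x * Complex.I)) {t : ℂ} {w : E}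
    (ht : D' w = t * D y) : b' w = t.im := by
  have hb2 : HasFDerivAt (fun x => -((b x : ℂ) * Complex.I)) _ y :=
    ((Complex.ofRealCLM.hasFDerivAt.comp y hb).mul_const Complex.I).neg
  -- The real factor `r` is not known to be differentiable. It is bypassed by differentiating `Im (D
  -- e^{-ib})`, which vanishes identically near `y`.
  have h1 := Complex.imCLM.hasFDerivAt.comp y (hD.mul hb2.cexp)
  have h2 : (Complex.imCLM ∘ fun x => D x * Complex.exp (-((b x : ℂ) * Complex.I))) =ᶠ[𝓝 y]
      fun _ => 0 := by
    filter_upwards [h] with x hx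
    obtain ⟨r, hr⟩ := hx
    simp only [Function.comp_apply, Complex.imCLM_apply]
    rw [hr, mul_assoc, ← Complex.exp_add, add_neg_cancel, Complex.exp_zero, mul_one,
      Complex.ofReal_im]
  have h3 := congrArg (fun A => A w)
    ((h1.congr_of_eventuallyEq h2.symm).unique (hasFDerivAt_const (0 : ℝ) y))
  obtain ⟨r, hr⟩ := h.self_of_nhds
  have hr0 : r ≠ 0 := by
    rintro rfl
    simp [hr] at hne
  have h4 : D y * Complex.exp (-((b y : ℂ) * Complex.I)) = r := by
    rw [hr, mul_assoc, ← Complex.exp_add, add_neg_cancel, Complex.exp_zero, mul_one]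
  have h5 : ((r : ℂ) * (t - b' w * Complex.I)).im = 0 := by
    rw [← h4]
    simp only [ContinuousLinearMap.comp_apply, add_apply, smul_apply, Complex.imCLM_apply, ht,
      zero_apply, smul_eq_mul, neg_apply, Complex.ofRealCLM_apply] at h3
    rw [← h3]
    congr 1
    simp
    ring
  rw [Complex.im_ofReal_mul] at h5
  have h6 := (mul_eq_zero.1 h5).resolve_left hr0
  simp at h6
  linarith

end ArgumentDerivative

/-! ### Signs of bases -/

section OrientSign

variable {n : ℕ} {W : Type*} [AddCommGroup W] [Module ℝ W]

open Classical in
/-- The sign of a basis of an oriented vector space. -/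
def orientSign (o : Orientation ℝ W (Fin n)) (v : Basis (Fin n) ℝ W) : ℝ :=
  if v.orientation = o then 1 else -1

lemma orientSign_eq_or (o : Orientation ℝ W (Fin n)) (v : Basis (Fin n) ℝ W) :
    orientSign o v = 1 ∨ orientSign o v = -1 := by
  unfold orientSign
  split_ifs <;> simp

lemma orientSign_mul_self (o : Orientation ℝ W (Fin n)) (v : Basis (Fin n) ℝ W) :
    orientSign o v * orientSign o v = 1 := by
  rcases orientSign_eq_or o v with h | h <;> simp [h]

/-- If `e` and `v` have the same orientation, the two signs agree and the determinant is positive;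
otherwise exactly one of them matches `o`, and the determinant is negative. -/
lemma det_mul_orientSign_pos (o : Orientation ℝ W (Fin n)) (e v : Basis (Fin n) ℝ W) :
    0 < e.det v * (orientSign o e * orientSign o v) := by
  have hne : e.det v ≠ 0 := (e.isUnit_det v).ne_zero
  by_cases h : e.orientation = v.orientation
  · have hs : orientSign o e = orientSign o v := by unfold orientSign; rw [h]
    rw [hs, orientSign_mul_self, mul_one]
    exact (e.orientation_eq_iff_det_pos v).1 h
  · have hneg : e.det v < 0 :=
      lt_of_le_of_ne (not_lt.1 fun hp => h ((e.orientation_eq_iff_det_pos v).2 hp)) hne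
    have hs : orientSign o e * orientSign o v = -1 := by
      have h2 : v.orientation = -e.orientation :=
        (e.orientation_ne_iff_eq_neg _).1 (Ne.symm h)
      have h4 : e.orientation ≠ -e.orientation := Module.Ray.ne_neg_self _
      unfold orientSign
      rcases e.orientation_eq_or_eq_neg o with h3 | h3
      · subst h3
        simp [h2, h4.symm]
      · subst h3
        simp [h2, h4]
    rw [hs]
    linarith

end OrientSign

/-! ### Existence and uniqueness of the Legendrian angle -/

section Angle

variable {n : ℕ} {M : Type*} [TopologicalSpace M] [ChartedSpace (RSpace n) M]
variable {g : MetricField (RSpace n) M} {φ : M → OddSphere n}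
variable {o : ∀ p : M, Orientation ℝ (TangentSpace 𝓘(ℝ, RSpace n) p) (Fin n)}

/-- The value of `φ^* Ω` on a family of tangent vectors. -/
def pullbackVolume (φ : M → OddSphere n) (p : M)
    (v : Fin n → TangentSpace 𝓘(ℝ, RSpace n) p) : ℂ :=
  complexVolume (φ p : CSpace (n + 1)) (fun i => sphereDeriv φ p (v i))

lemma isLegendrianAngle_iff {β : M → Real.Angle} : IsLegendrianAngle g φ o β ↔
    ∀ (p : M) (e : Basis (Fin n) ℝ (TangentSpace 𝓘(ℝ, RSpace n) p)),
      (∀ i j, g p (e i) (e j) = if i = j then 1 else 0) →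
      pullbackVolume φ p e = (orientSign (o p) e : ℂ) * ((β p).toCircle : ℂ) := by
  unfold IsLegendrianAngle orientSign pullbackVolume
  refine forall₃_congr fun p e he => ?_
  split_ifs <;> simp

lemma pullbackVolume_eq (φ : M → OddSphere n) (p : M)
    (e : Basis (Fin n) ℝ (TangentSpace 𝓘(ℝ, RSpace n) p))
    (v : Fin n → TangentSpace 𝓘(ℝ, RSpace n) p) :
    pullbackVolume φ p v = (e.det v : ℂ) * pullbackVolume φ p e :=
  complexVolume_map _ (sphereDeriv φ p).toLinearMap e v

namespace IsLegendrianImmersion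

variable [IsManifold 𝓘(ℝ, RSpace n) ∞ M] (hφ : IsLegendrianImmersion g φ)
include hφ

lemma exists_tangent_frame (p : M) : ∃ e : Basis (Fin n) ℝ (TangentSpace 𝓘(ℝ, RSpace n) p),
    ∀ i j, g p (e i) (e j) = if i = j then 1 else 0 :=
  hφ.exists_frame p

lemma norm_pullbackVolume {p : M} {e : Fin n → TangentSpace 𝓘(ℝ, RSpace n) p}
    (he : ∀ i j, g p (e i) (e j) = if i = j then 1 else 0) : ‖pullbackVolume φ p e‖ = 1 := by
  have h := hφ.orthonormal_frame (p := p) (e := e) he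
  rw [hφ.coordDeriv_eq] at h
  exact norm_complexVolume h

/-- The Legendrian angle gives the argument of `φ^* Ω` on every basis. -/
lemma exists_pullbackVolume_eq {β : M → Real.Angle} (hβ : IsLegendrianAngle g φ o β) (p : M)
    (v : Basis (Fin n) ℝ (TangentSpace 𝓘(ℝ, RSpace n) p)) :
    ∃ r : ℝ, 0 < r ∧
      pullbackVolume φ p v = ((r * orientSign (o p) v : ℝ) : ℂ) * ((β p).toCircle : ℂ) := by
  obtain ⟨e, he⟩ := hφ.exists_tangent_frame p
  refine ⟨_, det_mul_orientSign_pos (o p) e v, ?_⟩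
  rw [pullbackVolume_eq φ p e v, isLegendrianAngle_iff.1 hβ p e he, ← mul_assoc,
    ← Complex.ofReal_mul]
  congr 2
  linear_combination (-e.det v * orientSign (o p) e) * orientSign_mul_self (o p) v

/-- The angle is read off at each point from one chosen frame. Another orthonormal frame changes the
volume by its determinant, which is the product of the two orientation signs. The argument is
pointwise and asks no continuity of `o`. -/
lemma exists_isLegendrianAngle
    (o : ∀ p : M, Orientation ℝ (TangentSpace 𝓘(ℝ, RSpace n) p) (Fin n)) :
    ∃ β : M → Real.Angle, IsLegendrianAngle g φ o β := by
  choose e he using hφ.exists_tangent_frame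
  refine ⟨fun p => (Complex.arg (orientSign (o p) (e p) * pullbackVolume φ p (e p)) : ℝ), ?_⟩
  rw [isLegendrianAngle_iff]
  intro p v hv
  have hn : ‖(orientSign (o p) (e p) * pullbackVolume φ p (e p) : ℂ)‖ = 1 := by
    rw [norm_mul, hφ.norm_pullbackVolume (he p)]
    rcases orientSign_eq_or (o p) (e p) with h | h <;> simp [h]
  have hexp := Complex.norm_mul_exp_arg_mul_I
    (orientSign (o p) (e p) * pullbackVolume φ p (e p) : ℂ)
  rw [hn, Complex.ofReal_one, one_mul] at hexp
  rw [Real.Angle.toCircle_coe, Circle.coe_exp, hexp]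
  have hdet : (e p).det v = orientSign (o p) v * orientSign (o p) (e p) := by
    have h1 := det_mul_orientSign_pos (o p) (e p) v
    -- Both frames have volume of modulus one, and the determinant is the ratio of the volumes.
    have h2 : |(e p).det v| = 1 := by
      have h3 := hφ.norm_pullbackVolume hv
      rw [pullbackVolume_eq φ p (e p), norm_mul, hφ.norm_pullbackVolume (he p), mul_one,
        Complex.norm_real] at h3
      exact h3
    rcases orientSign_eq_or (o p) (e p) with h | h <;>
      rcases orientSign_eq_or (o p) v with h' | h' <;> rw [h, h'] at h1 ⊢ <;>
      rcases eq_or_eq_neg_of_abs_eq h2 with h3 | h3 <;> rw [h3] at h1 ⊢ <;>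
      first | (norm_num; done) | exact absurd h1 (by norm_num)
  rw [pullbackVolume_eq φ p (e p), hdet]
  push_cast
  ring

lemma isLegendrianAngle_unique {β β' : M → Real.Angle} (hβ : IsLegendrianAngle g φ o β)
    (hβ' : IsLegendrianAngle g φ o β') : β' = β := by
  funext p
  obtain ⟨e, he⟩ := hφ.exists_tangent_frame p
  have h1 := isLegendrianAngle_iff.1 hβ p e he
  rw [isLegendrianAngle_iff.1 hβ' p e he] at h1
  have hne : (orientSign (o p) e : ℂ) ≠ 0 := by
    rcases orientSign_eq_or (o p) e with h | h <;> simp [h]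
  have h2 := mul_left_cancel₀ hne h1
  rw [← Real.Angle.arg_toCircle (β' p), h2, Real.Angle.arg_toCircle]

/-- The determinant of `f` and of its derivatives along a basis `e`, in the chart at `p`. -/
def _root_.localVolume (φ : M → OddSphere n) (p : M) (e : Fin n → RSpace n) (y : RSpace n) : ℂ :=
  complexVolume (localLift φ p y) fun i => fderiv ℝ (localLift φ p) y (e i)

/-- The basis of `T_q M` whose expression in the chart at `p` is the basis `e`. -/
lemma exists_chart_basis {p : M} {y : RSpace n} (hy : y ∈ (chartAt (RSpace n) p).target)
    (e : Basis (Fin n) ℝ (RSpace n)) :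
    ∃ v : Basis (Fin n) ℝ (TangentSpace 𝓘(ℝ, RSpace n) ((chartAt (RSpace n) p).symm y)),
      (∀ i, v i = chartSymmDeriv p y (e i)) ∧
      localVolume φ p e y = pullbackVolume φ ((chartAt (RSpace n) p).symm y) v := by
  have : IsManifold 𝓘(ℝ, RSpace n) 1 M := IsManifold.of_le (n := ∞) (by simp)
  have hinj : Function.Injective (chartSymmDeriv p y).toLinearMap :=
    Function.LeftInverse.injective (mfderiv_chart_chartSymmDeriv hy)
  let L := LinearEquiv.ofInjectiveEndo (chartSymmDeriv p y).toLinearMap hinj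
  refine ⟨e.map L, fun i => rfl, ?_⟩
  unfold localVolume pullbackVolume
  congr 1
  funext i
  exact hφ.fderiv_localLift hy (e i)

end IsLegendrianImmersion

end Angle

/-! ### The differential of the Legendrian angle -/

section AngleDerivative

variable {n : ℕ} {M : Type*} [TopologicalSpace M] [ChartedSpace (RSpace n) M]
variable {g : MetricField (RSpace n) M} {φ : M → OddSphere n}
variable {o : ∀ p : M, Orientation ℝ (TangentSpace 𝓘(ℝ, RSpace n) p) (Fin n)}

/-- The rows of the matrix whose determinant is `localVolume`. -/
def localRows (φ : M → OddSphere n) (p : M) (e : Fin n → RSpace n) :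
    Fin (n + 1) → RSpace n → CSpace (n + 1) :=
  Fin.cons (localLift φ p) fun i y => fderiv ℝ (localLift φ p) y (e i)

lemma localRows_apply (φ : M → OddSphere n) (p : M) (e : Fin n → RSpace n) (y : RSpace n) :
    (fun i => localRows φ p e i y) =
      Fin.cons (localLift φ p y) fun i => fderiv ℝ (localLift φ p) y (e i) := by
  funext i
  refine Fin.cases ?_ (fun i => ?_) i <;> simp [localRows]

lemma localVolume_eq (φ : M → OddSphere n) (p : M) (e : Fin n → RSpace n) (y : RSpace n) :
    localVolume φ p e y = volumeForm n fun i => localRows φ p e i y := by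
  rw [localRows_apply]
  rfl

namespace IsLegendrianImmersion

variable [IsManifold 𝓘(ℝ, RSpace n) ∞ M] (hφ : IsLegendrianImmersion g φ)
include hφ

lemma contDiffAt_localLift {p : M} {y : RSpace n} (hy : y ∈ (chartAt (RSpace n) p).target) :
    ContDiffAt ℝ ∞ (localLift φ p) y :=
  contDiffAt_comp_chart_symm hy (hφ.contMDiff_coe _)

lemma contDiffAt_localVolume {p : M} {y : RSpace n} (hy : y ∈ (chartAt (RSpace n) p).target)
    (e : Fin n → RSpace n) : ContDiffAt ℝ ∞ (localVolume φ p e) y := by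
  have h : localVolume φ p e =
      (volumeForm n).toContinuousMultilinearMap ∘ fun y i => localRows φ p e i y :=
    funext fun y => localVolume_eq φ p e y
  rw [h]
  refine (volumeForm n).toContinuousMultilinearMap.contDiff.contDiffAt.comp y ?_
  refine contDiffAt_pi.2 fun i => ?_
  refine Fin.cases ?_ (fun i => ?_) i
  · exact hφ.contDiffAt_localLift hy
  · exact ((hφ.contDiffAt_localLift hy).fderiv_right (m := ∞) (by simp)).clm_apply contDiffAt_const

/-- The logarithmic derivative of `localVolume`. -/
lemma exists_hasFDerivAt_localVolume (p : M) {e : Fin n → RSpace n}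
    (he : ∀ i j, coordMetric g p (e i) (e j) = if i = j then 1 else 0) :
    ∃ D : RSpace n →L[ℝ] ℂ, HasFDerivAt (localVolume φ p e) D (chartAt (RSpace n) p p) ∧
      ∀ w, ∃ t : ℂ, D w = t * localVolume φ p e (chartAt (RSpace n) p p) ∧
        t.im = ∑ k, realInner (n + 1) (coordHess φ p (e k) (e k))
          (Complex.I • coordDeriv φ p w) := by
  set y := chartAt (RSpace n) p p with hy
  have hyt : y ∈ (chartAt (RSpace n) p).target := mem_chart_target _ p
  have hloc := hφ.isLocalLegendrian p
  -- The rows are `f` and `df(e_i)`; their derivatives are `df` and `w ↦ D²f(w, e_i)`.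
  let a' : Fin (n + 1) → RSpace n →L[ℝ] CSpace (n + 1) :=
    Fin.cons (coordDeriv φ p) fun i => (coordHess φ p).flip (e i)
  have ha : ∀ i, HasFDerivAt (localRows φ p e i) (a' i) y := by
    intro i
    refine Fin.cases ?_ (fun i => ?_) i
    · exact (hloc.differentiableAt hyt).hasFDerivAt
    · have h1 := (hloc.differentiableAt_fderiv hyt).hasFDerivAt.clm_apply
        (hasFDerivAt_const (e i) y)
      refine h1.congr_fderiv ?_
      ext1 w
      simp [a', coordHess, hy]
  have horth : Orthonormal ℂ fun i => localRows φ p e i y := by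
    rw [localRows_apply, hy, localLift_self]
    exact hφ.orthonormal_frame he
  obtain ⟨D, hD, hDw⟩ := hasFDerivAt_volumeForm ha horth
  refine ⟨D, ?_, fun w => ⟨∑ i, inner ℂ (localRows φ p e i y) (a' i w), ?_, ?_⟩⟩
  · exact hD.congr_of_eventuallyEq (Filter.Eventually.of_forall fun x => localVolume_eq φ p e x)
  · rw [hDw, localVolume_eq]
  · have him : ∀ a b : CSpace (n + 1),
        (inner ℂ a b).im = realInner (n + 1) b (Complex.I • a) := by
      intro a b
      rw [inner_eq_realInner, realInner_comm b]
      simp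
    rw [Fin.sum_univ_succ, Complex.add_im, Complex.im_sum]
    -- The row `f` contributes `⟨df w, Jf⟩`, zero by the Legendrian condition.
    have h0 : (inner ℂ (localRows φ p e 0 y) (a' 0 w)).im = 0 := by
      rw [him]
      exact hloc.legendrian y hyt w
    rw [h0, zero_add]
    refine Finset.sum_congr rfl fun k _ => ?_
    rw [him]
    have h1 := hloc.cubic_symm hyt (e k) w (e k)
    rw [hloc.symm hyt] at h1
    -- Total symmetry of the cubic form exchanges `w` with one `e_k` and produces the trace that
    -- occurs in `H`.
    have h2 : realInner (n + 1) (coordHess φ p w (e k)) (Complex.I • coordDeriv φ p (e k)) =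
      realInner (n + 1) (coordHess φ p (e k) (e k)) (Complex.I • coordDeriv φ p w) := by
      have h3 := hloc.symm hyt (e k) w
      have h4 := hloc.cubic_symm hyt (e k) w (e k)
      rw [h3] at h4
      exact h4
    exact h2

/-- The differential of a smooth determination of the Legendrian angle: `∇β = -n JH`. -/
lemma gradientField_eq {β : M → Real.Angle} (hβ : IsLegendrianAngle g φ o β) (hn : n ≠ 0)
    {p : M} {b : M → ℝ} (hb : MDifferentiableAt 𝓘(ℝ, RSpace n) 𝓘(ℝ, ℝ) b p)
    (hlift : ∀ᶠ q in 𝓝 p, (b q : Real.Angle) = β q) {x : TangentSpace 𝓘(ℝ, RSpace n) p}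
    (hx : sphereDeriv φ p x = Complex.I • meanVec g φ p) :
    gradientField g b p = (-(n : ℝ)) • x := by
  have hM : IsManifold 𝓘(ℝ, RSpace n) 1 M := IsManifold.of_le (n := ∞) (by simp)
  set y := chartAt (RSpace n) p p with hy
  have hyt : y ∈ (chartAt (RSpace n) p).target := mem_chart_target _ p
  obtain ⟨e, he⟩ := hφ.exists_frame p
  obtain ⟨D, hD, hDw⟩ := hφ.exists_hasFDerivAt_localVolume p he
  have hsymm : Filter.Tendsto (chartAt (RSpace n) p).symm (𝓝 y) (𝓝 p) := by
    have := (chartAt (RSpace n) p).continuousAt_symm hyt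
    rwa [ContinuousAt, hy, chart_symm_chart] at this
  have hdb : DifferentiableAt ℝ (fun x => b ((chartAt (RSpace n) p).symm x)) y := by
    rw [← mdifferentiableAt_iff_differentiableAt]
    refine MDifferentiableAt.comp (I' := 𝓘(ℝ, RSpace n)) (g := b) y ?_
      (mdifferentiableAt_chart_symm hyt)
    rwa [hy, chart_symm_chart]
  have hne : localVolume φ p e y ≠ 0 := by
    have h1 := hφ.norm_pullbackVolume (p := p) (e := e) he
    have h2 : localVolume φ p e y = pullbackVolume φ p e := by
      unfold localVolume pullbackVolume
      rw [hy, localLift_self]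
      congr 1
      funext i
      exact congrArg (fun A : RSpace n →L[ℝ] CSpace (n + 1) => A (e i)) (hφ.coordDeriv_eq p)
    rw [h2]
    intro h3
    simp [h3] at h1
  -- The constant frame `e` is orthonormal at `p` only. Nearby its volume is still a nonzero real
  -- multiple of `e^{iβ}`, which is all that the derivative of the argument requires; the sign of
  -- the multiple is irrelevant.
  have hev : ∀ᶠ x in 𝓝 y, ∃ r : ℝ, localVolume φ p e x =
      r * Complex.exp (b ((chartAt (RSpace n) p).symm x) * Complex.I) := by
    filter_upwards [eventually_mem_chart_target p, hsymm.eventually hlift] with x hx1 hx2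
    obtain ⟨v, -, hv⟩ := hφ.exists_chart_basis hx1 e
    obtain ⟨r, -, hr⟩ := hφ.exists_pullbackVolume_eq hβ _ v
    refine ⟨r * orientSign (o _) v, ?_⟩
    rw [hv, hr, ← hx2, Real.Angle.toCircle_coe, Circle.coe_exp]
  have hn0 : (n : ℝ) ≠ 0 := by exact_mod_cast hn
  have hkey : ∀ w : RSpace n, (mfderiv 𝓘(ℝ, RSpace n) 𝓘(ℝ, ℝ) b p w : ℝ) =
      -(n : ℝ) * coordMetric g p x w := by
    intro w
    obtain ⟨t, ht, htim⟩ := hDw w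
    have h1 := hasFDerivAt_angle hD hdb.hasFDerivAt hne hev ht
    rw [fderiv_comp_chart_symm_self hb] at h1
    have h2 := hφ.coordMetric_of_coordDeriv_eq p (x := x)
      (by rw [hφ.coordDeriv_eq]; exact hx) he w
    refine h1.trans ?_
    rw [h2, htim]
    field_simp
  have hd : coordMetric g p (gradientField g b p) =
      (mfderiv 𝓘(ℝ, RSpace n) 𝓘(ℝ, ℝ) b p : RSpace n →L[ℝ] ℝ) :=
    ContinuousLinearMap.apply_inverse_apply (hφ.coordMetric_nondegenerate p) _
  have huniq : ∀ a x : RSpace n, (∀ w, coordMetric g p a w = -n * coordMetric g p x w) →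
      a = (-(n : ℝ)) • x := by
    intro a x h
    refine sub_eq_zero.1 (hφ.coordMetric_nondegenerate p _ ?_)
    ext1 w
    rw [map_sub, map_smul, sub_apply, smul_apply, h, smul_eq_mul, sub_self]
    rfl
  refine huniq (gradientField g b p) x fun w => ?_
  rw [hd]
  exact hkey w

end IsLegendrianImmersion

end AngleDerivative

/-! ### Smooth determinations of the angle and harmonicity -/

section LocalDetermination

variable {n : ℕ} {M : Type*} [TopologicalSpace M] [ChartedSpace (RSpace n) M]
variable {g : MetricField (RSpace n) M} {φ : M → OddSphere n}

lemma orientSign_eq_of_orientation_map {W V : Type*} [AddCommGroup W] [Module ℝ W] [AddCommGroup V]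
    [Module ℝ V] {o : Orientation ℝ W (Fin n)} {o' : Orientation ℝ V (Fin n)} (T : W ≃ₗ[ℝ] V)
    (h : Orientation.map (Fin n) T o = o') {v : Basis (Fin n) ℝ W} {e : Basis (Fin n) ℝ V}
    (hv : ∀ i, T (v i) = e i) : orientSign o v = orientSign o' e := by
  have he : v.map T = e := Basis.eq_of_apply_eq fun i => by rw [Basis.map_apply, hv]
  unfold orientSign
  rw [← he, Basis.orientation_map, ← h, (Orientation.map (Fin n) T).injective.eq_iff]

/-- Over a point of the chart domain the trivialization at `p` is the derivative of the chart at
`p`. This connects `IsManifoldOrientation`, stated with trivializations, to the frames transported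
by the chart. -/
lemma trivializationAt_chartSymmDeriv [IsManifold 𝓘(ℝ, RSpace n) 1 M] {p : M} {y : RSpace n}
    (hy : y ∈ (chartAt (RSpace n) p).target)
    (hq : (chartAt (RSpace n) p).symm y ∈
      (trivializationAt (RSpace n) (TangentSpace 𝓘(ℝ, RSpace n)) p).baseSet) (u : RSpace n) :
    (trivializationAt (RSpace n) (TangentSpace 𝓘(ℝ, RSpace n)) p).continuousLinearEquivAt ℝ
      ((chartAt (RSpace n) p).symm y) hq (chartSymmDeriv p y u) = u := by
  have h1 := TangentBundle.continuousLinearMapAt_trivializationAt (I := 𝓘(ℝ, RSpace n))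
    ((chartAt (RSpace n) p).map_target hy)
  have h2 : (trivializationAt (RSpace n) (TangentSpace 𝓘(ℝ, RSpace n)) p).continuousLinearEquivAt ℝ
      ((chartAt (RSpace n) p).symm y) hq (chartSymmDeriv p y u) =
      (trivializationAt (RSpace n) (TangentSpace 𝓘(ℝ, RSpace n)) p).continuousLinearMapAt ℝ
      ((chartAt (RSpace n) p).symm y) (chartSymmDeriv p y u) := by
    rw [Bundle.Trivialization.coe_continuousLinearEquivAt_eq,
      Bundle.Trivialization.continuousLinearMapAt_apply]
  rw [h2, h1]
  exact mfderiv_chart_chartSymmDeriv hy u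

namespace IsLegendrianImmersion

variable {o : ∀ p : M, Orientation ℝ (TangentSpace 𝓘(ℝ, RSpace n) p) (Fin n)}
variable (hφ : IsLegendrianImmersion g φ)
include hφ

/-- The differential is injective, so the field in the definition is unique and any representative
of `JH` decides C-minimality. -/
lemma isCMinimal_iff {X : ∀ p : M, TangentSpace 𝓘(ℝ, RSpace n) p}
    (hX : ∀ p, sphereDeriv φ p (X p) = Complex.I • meanVec g φ p) :
    IsCMinimal g φ ↔ ∀ p, divergence g X p = 0 := by
  refine ⟨?_, fun h => ⟨X, hX, h⟩⟩
  rintro ⟨Y, hY, h⟩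
  have : X = Y := funext fun p => hφ.sphereDeriv_injective p ((hX p).trans (hY p).symm)
  rwa [this]

variable [IsManifold 𝓘(ℝ, RSpace n) ∞ M]

/-- The sign of the transported frame for `o` at the variable point equals that of `e` for `o p`:
this is where local constancy of the orientation is used. The sign no longer depends on `y`. -/
lemma exists_localVolume_eq [IsManifold 𝓘(ℝ, RSpace n) 1 M] {β : M → Real.Angle}
    (hβ : IsLegendrianAngle g φ o β) {p : M} {y : RSpace n}
    (hy : y ∈ (chartAt (RSpace n) p).target) (e : Basis (Fin n) ℝ (RSpace n))
    (ho : ∃ hq : (chartAt (RSpace n) p).symm y ∈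
        (trivializationAt (RSpace n) (TangentSpace 𝓘(ℝ, RSpace n)) p).baseSet,
      Orientation.map (Fin n)
        ((trivializationAt (RSpace n) (TangentSpace 𝓘(ℝ, RSpace n)) p).continuousLinearEquivAt ℝ
          ((chartAt (RSpace n) p).symm y) hq).toLinearEquiv
        (o ((chartAt (RSpace n) p).symm y)) = (o p : Orientation ℝ (RSpace n) (Fin n))) :
    ∃ r : ℝ, 0 < r ∧ localVolume φ p e y =
      ((r * orientSign (o p : Orientation ℝ (RSpace n) (Fin n)) e : ℝ) : ℂ) *
        ((β ((chartAt (RSpace n) p).symm y)).toCircle : ℂ) := by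
  obtain ⟨hq, ho⟩ := ho
  obtain ⟨v, hv, hvol⟩ := hφ.exists_chart_basis hy e
  obtain ⟨r, hr, hvol2⟩ := hφ.exists_pullbackVolume_eq hβ _ v
  refine ⟨r, hr, ?_⟩
  rw [hvol, hvol2]
  have := orientSign_eq_of_orientation_map _ ho (v := v) (e := e) fun i => by
    rw [hv]
    exact trivializationAt_chartSymmDeriv hy hq (e i)
  rw [this]
  rfl

/-- The Legendrian angle has local smooth determinations. -/
lemma exists_local_determination (ho : IsManifoldOrientation o) {β : M → Real.Angle}
    (hβ : IsLegendrianAngle g φ o β) (p : M) :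
    ∃ (U : Set M) (b : M → ℝ), IsOpen U ∧ p ∈ U ∧
      ContMDiffOn 𝓘(ℝ, RSpace n) 𝓘(ℝ, ℝ) ∞ b U ∧ ∀ q ∈ U, (b q : Real.Angle) = β q := by
  have hM : IsManifold 𝓘(ℝ, RSpace n) 1 M := IsManifold.of_le (n := ∞) (by simp)
  obtain ⟨e, -⟩ := hφ.exists_frame p
  set c := chartAt (RSpace n) p with hc
  have hkey : ∀ q ∈ c.source, (∃ hq : q ∈
        (trivializationAt (RSpace n) (TangentSpace 𝓘(ℝ, RSpace n)) p).baseSet,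
      Orientation.map (Fin n)
        ((trivializationAt (RSpace n) (TangentSpace 𝓘(ℝ, RSpace n)) p).continuousLinearEquivAt ℝ
          q hq).toLinearEquiv (o q) = (o p : Orientation ℝ (RSpace n) (Fin n))) →
      ∃ r : ℝ, 0 < r ∧ localVolume φ p e (c q) =
        ((r * orientSign (o p : Orientation ℝ (RSpace n) (Fin n)) e : ℝ) : ℂ) *
        ((β q).toCircle : ℂ) := by
    intro q hq h
    have h1 := hφ.exists_localVolume_eq hβ (c.map_source hq) e (by rwa [← hc, c.left_inv hq])
    rwa [← hc, c.left_inv hq] at h1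
  obtain ⟨r₀, hr₀, hD₀⟩ := hkey p (mem_chart_source _ p) (ho p).self_of_nhds
  set s : ℝ := orientSign (o p : Orientation ℝ (RSpace n) (Fin n)) e with hs
  have hs0 : s ≠ 0 := by
    rcases orientSign_eq_or (o p : Orientation ℝ (RSpace n) (Fin n)) e with h | h <;>
      rw [hs, h] <;> norm_num
  have hne : localVolume φ p e (c p) ≠ 0 := by
    rw [hD₀]
    refine mul_ne_zero ?_ (Circle.coe_ne_zero _)
    exact_mod_cast mul_ne_zero hr₀.ne' hs0
  -- Dividing by the value at `p` brings the volume near `1`, inside the slit plane, where the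
  -- logarithm is smooth; the constant `(β p).toReal` restores the angle.
  let F : RSpace n → ℝ := fun y =>
    (β p).toReal + (Complex.log (localVolume φ p e y / localVolume φ p e (c p))).im
  have hFsmooth : ∀ y ∈ c.target,
      localVolume φ p e y / localVolume φ p e (c p) ∈ Complex.slitPlane →
      ContDiffAt ℝ ∞ F y := by
    intro y hy hslit
    have h1 : ContDiffAt ℝ ∞ (fun y => localVolume φ p e y / localVolume φ p e (c p)) y :=
      (hφ.contDiffAt_localVolume hy e).div_const _
    have h2 := (Complex.contDiffAt_log hslit (n := ∞)).restrict_scalars ℝ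
    have h3 : ContDiffAt ℝ ∞ (fun y =>
        Complex.log (localVolume φ p e y / localVolume φ p e (c p))) y :=
      ContDiffAt.comp (g := Complex.log) y h2 h1
    have h4 : ContDiffAt ℝ ∞ (fun y => Complex.imCLM
        (Complex.log (localVolume φ p e y / localVolume φ p e (c p)))) y :=
      Complex.imCLM.contDiff.contDiffAt.comp y h3
    exact contDiffAt_const.add h4
  have hcont : ContinuousAt (fun q => localVolume φ p e (c q) / localVolume φ p e (c p)) p := by
    refine ContinuousAt.div_const ?_ _
    exact ContinuousAt.comp (g := localVolume φ p e)
      (hφ.contDiffAt_localVolume (mem_chart_target _ p) e).continuousAt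
      (c.continuousAt (mem_chart_source _ p))
  have hslit : ∀ᶠ q in 𝓝 p,
      localVolume φ p e (c q) / localVolume φ p e (c p) ∈ Complex.slitPlane :=
    hcont.eventually_mem (Complex.isOpen_slitPlane.mem_nhds (by simp [div_self hne]))
  obtain ⟨U, hU, hUo, hpU⟩ := eventually_nhds_iff.1
    (((ho p).and hslit).and (c.open_source.mem_nhds (mem_chart_source _ p)))
  refine ⟨U, fun q => F (c q), hUo, hpU, ?_, ?_⟩
  · intro q hq
    obtain ⟨⟨-, h2⟩, h3⟩ := hU q hq
    have h4 := (hFsmooth (c q) (c.map_source h3) h2).contMDiffAt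
    exact (ContMDiffAt.comp q h4 (contMDiffAt_of_mem_maximalAtlas
      (IsManifold.chart_mem_maximalAtlas p) h3)).contMDiffWithinAt
  · intro q hq
    obtain ⟨⟨h1, h2⟩, h3⟩ := hU q hq
    obtain ⟨r, hr, hD⟩ := hkey q h3 h1
    -- The common sign `s` cancels, and a positive factor does not change the argument.
    have hquot : localVolume φ p e (c q) / localVolume φ p e (c p) =
        ((r / r₀ : ℝ) : ℂ) * ((β q - β p).toCircle : ℂ) := by
      rw [hD, hD₀, sub_eq_add_neg, Real.Angle.toCircle_add, Real.Angle.toCircle_neg]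
      have h5 : (s : ℂ) ≠ 0 := by exact_mod_cast hs0
      have h6 : (r₀ : ℂ) ≠ 0 := by exact_mod_cast hr₀.ne'
      have h7 := Circle.coe_ne_zero (β p).toCircle
      push_cast
      field_simp
    change (((β p).toReal + (Complex.log _).im : ℝ) : Real.Angle) = β q
    rw [Complex.log_im, hquot, Complex.arg_real_mul _ (div_pos hr hr₀), Real.Angle.coe_add,
      Real.Angle.coe_toReal, Real.Angle.arg_toCircle]
    abel

/-- The relation between `JH` and the Laplacian of the Legendrian angle. -/
lemma laplaceBeltrami_eq {β : M → Real.Angle} (hβ : IsLegendrianAngle g φ o β)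
    {X : ∀ p : M, TangentSpace 𝓘(ℝ, RSpace n) p}
    (hX : ∀ p, sphereDeriv φ p (X p) = Complex.I • meanVec g φ p)
    {U : Set M} {b : M → ℝ} (hU : IsOpen U) (hb : ContMDiffOn 𝓘(ℝ, RSpace n) 𝓘(ℝ, ℝ) ∞ b U)
    (hbβ : ∀ q ∈ U, (b q : Real.Angle) = β q) {q : M} (hq : q ∈ U) :
    laplaceBeltrami g b q = -(n : ℝ) * divergence g X q := by
  -- `H` carries the factor `1/n`, so `∇β = -n JH` is available only for `n ≠ 0`; for `n = 0` both
  -- sides vanish.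
  rcases eq_or_ne n 0 with rfl | hn
  · simp [laplaceBeltrami, divergence_of_subsingleton]
  rw [← divergence_smul]
  refine divergence_congr ?_
  filter_upwards [hU.mem_nhds hq] with x hx
  refine hφ.gradientField_eq hβ hn ?_ ?_ (hX x)
  · exact ((hb x hx).contMDiffAt (hU.mem_nhds hx)).mdifferentiableAt (by simp)
  · filter_upwards [hU.mem_nhds hx] with z hz using hbβ z hz

lemma exists_field : ∃ X : ∀ p : M, TangentSpace 𝓘(ℝ, RSpace n) p,
    ∀ p, sphereDeriv φ p (X p) = Complex.I • meanVec g φ p := by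
  have h : ∀ p, ∃ x : TangentSpace 𝓘(ℝ, RSpace n) p,
      sphereDeriv φ p x = Complex.I • meanVec g φ p := by
    intro p
    obtain ⟨x, hx⟩ := hφ.exists_coordDeriv_eq_I_meanVec p
    rw [hφ.coordDeriv_eq] at hx
    exact ⟨x, hx⟩
  choose X hX using h
  exact ⟨X, hX⟩

/-- Both directions are `Δb = -n div JH`. The forward one needs smooth determinations and hence the
continuity of the orientation; the converse uses the determinations supplied by harmonicity. -/
theorem isCMinimal_iff_isHarmonicAngle (ho : IsManifoldOrientation o) {β : M → Real.Angle}
    (hβ : IsLegendrianAngle g φ o β) : IsCMinimal g φ ↔ IsHarmonicAngle g β := by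
  obtain ⟨X, hX⟩ := hφ.exists_field
  rw [hφ.isCMinimal_iff hX]
  constructor
  · intro h p
    obtain ⟨U, b, hU, hp, hb, hbβ⟩ := hφ.exists_local_determination ho hβ p
    refine ⟨U, b, hU, hp, hb, fun q hq => ⟨hbβ q hq, ?_⟩⟩
    rw [hφ.laplaceBeltrami_eq hβ hX hU hb hbβ hq, h, mul_zero]
  · intro h p
    rcases eq_or_ne n 0 with rfl | hn
    · exact divergence_of_subsingleton _ _ _
    obtain ⟨U, b, hU, hp, hb, hbβ⟩ := h p
    have h1 := hφ.laplaceBeltrami_eq hβ hX hU hb (fun q hq => (hbβ q hq).1) hp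
    rw [(hbβ p hp).2] at h1
    have hn0 : (-(n : ℝ)) ≠ 0 := neg_ne_zero.2 (by exact_mod_cast hn)
    exact (mul_eq_zero.1 h1.symm).resolve_left hn0

end IsLegendrianImmersion

end LocalDetermination

/-! ### The Fubini-Study metric pulled back to homogeneous coordinates -/

namespace CProj

variable {n : ℕ}

/-- The pull-back of the Fubini-Study metric to `ℂ^{n+1} ∖ {0}`. -/
def hopfForm (z : CSpace (n + 1)) : CSpace (n + 1) →L[ℝ] CSpace (n + 1) →L[ℝ] ℝ :=
  (realInner (n + 1) z z)⁻¹ • realInner (n + 1)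
    - ((realInner (n + 1) z z) ^ 2)⁻¹ •
      ((realInner (n + 1) z).smulRight (realInner (n + 1) z)
        + (realInner (n + 1) (Complex.I • z)).smulRight (realInner (n + 1) (Complex.I • z)))

lemma hopfForm_apply (z u v : CSpace (n + 1)) :
    hopfForm z u v = (realInner (n + 1) z z)⁻¹ * realInner (n + 1) u v
      - ((realInner (n + 1) z z) ^ 2)⁻¹ *
        (realInner (n + 1) z u * realInner (n + 1) z v
          + realInner (n + 1) (Complex.I • z) u * realInner (n + 1) (Complex.I • z) v) := by
  simp only [hopfForm, sub_apply, smul_apply, add_apply, ContinuousLinearMap.smulRight_apply,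
    smul_eq_mul]

lemma hopfForm_eq (z u v : CSpace (n + 1)) :
    hopfForm z u v = ((‖z‖ ^ 2) ^ 2)⁻¹ *
      (‖z‖ ^ 2 * inner ℂ u v - inner ℂ u z * inner ℂ z v : ℂ).re := by
  have hsym : (inner ℂ z u : ℂ) = (starRingEnd ℂ) (inner ℂ u z) := (inner_conj_symm z u).symm
  rcases eq_or_ne z 0 with rfl | hz
  · simp [hopfForm_apply]
  have hpos : ‖z‖ ≠ 0 := norm_ne_zero_iff.2 hz
  rw [hopfForm_apply, realInner_self]
  simp only [realInner_apply, inner_smul_left, hsym]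
  generalize (inner ℂ u z : ℂ) = a
  generalize (inner ℂ z v : ℂ) = b
  generalize (inner ℂ u v : ℂ) = c
  rw [← Complex.ofReal_pow]
  simp only [Complex.sub_re, Complex.mul_re, Complex.conj_re, Complex.conj_im, Complex.conj_I,
    Complex.neg_re, Complex.neg_im, Complex.I_re, Complex.I_im, Complex.ofReal_re,
    Complex.ofReal_im]
  field_simp
  ring

lemma hopfForm_symm (z u v : CSpace (n + 1)) : hopfForm z u v = hopfForm z v u := by
  rw [hopfForm_apply, hopfForm_apply, realInner_comm u v]
  ring

/-- The complex line through `z` is vertical, that is, in the kernel of the form. With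
`hopfForm_smul`, this is the invariance that lets the form descend to lines. -/
lemma hopfForm_add_smul (z u v : CSpace (n + 1)) (c : ℂ) :
    hopfForm z (u + c • z) v = hopfForm z u v := by
  rw [hopfForm_eq, hopfForm_eq]
  congr 2
  rw [inner_add_left, inner_add_left, inner_smul_left, inner_smul_left,
    inner_self_eq_norm_sq_to_K]
  simp only [Complex.coe_algebraMap]
  ring

lemma hopfForm_smul {c : ℂ} (hc : c ≠ 0) (z u v : CSpace (n + 1)) :
    hopfForm (c • z) (c • u) (c • v) = hopfForm z u v := by
  have hn : ‖c‖ ≠ 0 := norm_ne_zero_iff.2 hc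
  have hcc : (starRingEnd ℂ) c * c = ((‖c‖ ^ 2 : ℝ) : ℂ) := by
    rw [mul_comm, Complex.mul_conj, Complex.normSq_eq_norm_sq]
  rw [hopfForm_eq, hopfForm_eq, norm_smul]
  have h : ((((‖c‖ * ‖z‖ : ℝ) : ℂ) ^ 2) * inner ℂ (c • u) (c • v)
      - inner ℂ (c • u) (c • z) * inner ℂ (c • z) (c • v) : ℂ) =
      (((‖c‖ ^ 2) ^ 2 : ℝ) : ℂ) *
        ((‖z‖ : ℂ) ^ 2 * inner ℂ u v - inner ℂ u z * inner ℂ z v) := by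
    simp only [inner_smul_left, inner_smul_right]
    push_cast at hcc ⊢
    linear_combination ((‖c‖ : ℂ) ^ 2 * (‖z‖ : ℂ) ^ 2 * inner ℂ u v
      - inner ℂ u z * inner ℂ z v * ((starRingEnd ℂ) c * c + (‖c‖ : ℂ) ^ 2)) * hcc
  rw [h, Complex.re_ofReal_mul]
  field_simp

lemma differentiable_realInner_smulRight {E : Type*} [NormedAddCommGroup E] [NormedSpace ℝ E]
    (A : E →L[ℝ] E →L[ℝ] ℝ) : Differentiable ℝ fun z => (A z).smulRight (A z) := by
  have h1 : Differentiable ℝ fun z => ContinuousLinearMap.smulRightL ℝ E (E →L[ℝ] ℝ) (A z) :=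
    ((ContinuousLinearMap.smulRightL ℝ E (E →L[ℝ] ℝ)).comp A).differentiable
  exact h1.clm_apply A.differentiable

/-- Multiplication by `i`, as a continuous real linear map. -/
def mulI (m : ℕ) : CSpace m →L[ℝ] CSpace m :=
  (LinearMap.restrictScalars ℝ (Complex.I • LinearMap.id : CSpace m →ₗ[ℂ] CSpace m)
    ).toContinuousLinearMap

@[simp] lemma mulI_apply {m : ℕ} (u : CSpace m) : mulI m u = Complex.I • u := rfl

lemma differentiableAt_hopfForm {z : CSpace (n + 1)} (hz : z ≠ 0) :
    DifferentiableAt ℝ hopfForm z := by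
  have hN : DifferentiableAt ℝ (fun x => realInner (n + 1) x x) z :=
    (realInner (n + 1)).differentiableAt.clm_apply differentiableAt_id
  have hN0 : realInner (n + 1) z z ≠ 0 := by
    rw [realInner_self]; exact pow_ne_zero 2 (norm_ne_zero_iff.2 hz)
  refine DifferentiableAt.sub ((hN.inv hN0).smul (differentiableAt_const _)) ?_
  refine DifferentiableAt.smul ((hN.pow 2).inv (pow_ne_zero 2 hN0)) (DifferentiableAt.add ?_ ?_)
  · exact differentiable_realInner_smulRight _ z
  · exact differentiable_realInner_smulRight ((realInner (n + 1)).comp (mulI (n + 1))) z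

lemma fderiv_hopfForm {z : CSpace (n + 1)} (hz : ‖z‖ = 1) (a b c : CSpace (n + 1)) :
    fderiv ℝ hopfForm z a b c =
      -2 * realInner (n + 1) z a * realInner (n + 1) b c
      + 4 * realInner (n + 1) z a * (realInner (n + 1) z b * realInner (n + 1) z c
        + realInner (n + 1) (Complex.I • z) b * realInner (n + 1) (Complex.I • z) c)
      - (realInner (n + 1) a b * realInner (n + 1) z c + realInner (n + 1) z b * realInner (n + 1) a c
        + realInner (n + 1) (Complex.I • a) b * realInner (n + 1) (Complex.I • z) c
        + realInner (n + 1) (Complex.I • z) b * realInner (n + 1) (Complex.I • a) c) := by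
  have hz0 : z ≠ 0 := by rintro rfl; simp at hz
  have hN1 : realInner (n + 1) z z = 1 := by rw [realInner_self, hz, one_pow]
  rw [← fderiv_apply_apply (differentiableAt_hopfForm hz0)]
  have hN : HasFDerivAt (fun x => realInner (n + 1) x x) _ z :=
    (realInner (n + 1)).hasFDerivAt.clm_apply (hasFDerivAt_id z)
  have hR : ∀ d, HasFDerivAt (fun x => realInner (n + 1) x d) ((realInner (n + 1)).flip d) z :=
    fun d => ((realInner (n + 1)).flip d).hasFDerivAt
  have hI : ∀ d, HasFDerivAt (fun x => realInner (n + 1) (Complex.I • x) d)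
      (((realInner (n + 1)).flip d).comp (mulI (n + 1))) z :=
    fun d => (((realInner (n + 1)).flip d).comp (mulI (n + 1))).hasFDerivAt
  have hinv : HasFDerivAt (fun x => (realInner (n + 1) x x)⁻¹) _ z :=
    HasDerivAt.comp_hasFDerivAt (f := fun x => realInner (n + 1) x x) z
      (hasDerivAt_inv (by rw [hN1]; norm_num)) hN
  have hinv2 : HasFDerivAt (fun x => (realInner (n + 1) x x ^ 2)⁻¹) _ z :=
    HasDerivAt.comp_hasFDerivAt (f := fun x => realInner (n + 1) x x ^ 2) z
      (hasDerivAt_inv (by rw [hN1]; norm_num)) (hN.pow 2)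
  have htot := (hinv.mul_const (realInner (n + 1) b c)).sub
    (hinv2.mul (((hR b).mul (hR c)).add ((hI b).mul (hI c))))
  have hfun : (fun x => hopfForm x b c) = _ := funext fun x => hopfForm_apply x b c
  rw [hfun]
  have := congrArg (fun A => A a) htot.fderiv
  refine Eq.trans this ?_
  simp [hN1, realInner_comm a z]
  ring

/-- The Christoffel symbols of the first kind of `hopfForm` vanish on horizontal vectors whose
Hermitian product is real. -/
lemma koszul_hopfForm {z : CSpace (n + 1)} (hz : ‖z‖ = 1) {a b : CSpace (n + 1)}
    (ha : realInner (n + 1) a z = 0) (ha' : realInner (n + 1) a (Complex.I • z) = 0)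
    (hb : realInner (n + 1) b z = 0) (hb' : realInner (n + 1) b (Complex.I • z) = 0)
    (hab : realInner (n + 1) a (Complex.I • b) = 0) (c : CSpace (n + 1)) :
    koszul hopfForm z a b c = 0 := by
  have h1 : realInner (n + 1) (Complex.I • a) b = 0 := by rw [realInner_I_left, hab, neg_zero]
  have h2 : realInner (n + 1) (Complex.I • b) a = 0 := by rw [realInner_comm, hab]
  rw [realInner_comm] at ha ha' hb hb'
  -- Each of the first two derivatives reduces to `-⟨a,b⟩⟨z,c⟩`, and the third to `-2⟨a,b⟩⟨z,c⟩`, so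
  -- the Koszul combination cancels.
  simp only [koszul, fderiv_hopfForm hz, ha, ha', hb, hb', h1, h2, realInner_comm b a]
  ring

/-! ### Affine coordinates -/

/-- The inclusion of `ℂ^n` as the hyperplane where the `j`-th coordinate vanishes. -/
def hyperplane (j : Fin (n + 1)) (a : CSpace n) : CSpace (n + 1) :=
  WithLp.toLp 2 (j.insertNth (α := fun _ => ℂ) 0 a)

@[simp] lemma hyperplane_same (j : Fin (n + 1)) (a : CSpace n) : hyperplane j a j = 0 := by
  simp [hyperplane]

@[simp] lemma hyperplane_succAbove (j : Fin (n + 1)) (a : CSpace n) (k : Fin n) :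
    hyperplane j a (j.succAbove k) = a k := by
  simp [hyperplane]

lemma hyperplane_smul (j : Fin (n + 1)) (c : ℂ) (a : CSpace n) :
    hyperplane j (c • a) = c • hyperplane j a := by
  ext i
  induction i using Fin.succAboveCases j with
  | x => simp
  | p k => simp

lemma inner_hyperplane (j : Fin (n + 1)) (z : CSpace (n + 1)) (a : CSpace n) :
    inner ℂ z (hyperplane j a) = inner ℂ (WithLp.toLp 2 fun k => z (j.succAbove k)) a := by
  simp [PiLp.inner_apply, Fin.sum_univ_succAbove _ j]

lemma realInner_hyperplane (j : Fin (n + 1)) (a b : CSpace n) :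
    realInner (n + 1) (hyperplane j a) (hyperplane j b) = realInner n a b := by
  rw [realInner_apply, realInner_apply, inner_hyperplane]
  congr 2
  ext k
  simp

lemma realInner_affineVec (j : Fin (n + 1)) (w b : CSpace n) :
    realInner (n + 1) (affineVec j w) (hyperplane j b) = realInner n w b := by
  rw [realInner_apply, realInner_apply, inner_hyperplane]
  congr 2
  ext k
  simp

lemma realInner_affineVec_self (j : Fin (n + 1)) (w : CSpace n) :
    realInner (n + 1) (affineVec j w) (affineVec j w) = 1 + ‖w‖ ^ 2 := by
  rw [realInner_self, EuclideanSpace.norm_sq_eq, EuclideanSpace.norm_sq_eq,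
    Fin.sum_univ_succAbove _ j]
  simp

/-- The Fubini-Study metric in terms of `hopfForm`. -/
lemma fubiniStudyForm_eq_hopfForm (j : Fin (n + 1)) (w a b : CSpace n) :
    fubiniStudyForm w a b = hopfForm (affineVec j w) (hyperplane j a) (hyperplane j b) := by
  have hI : ∀ c, realInner (n + 1) (Complex.I • affineVec j w) (hyperplane j c) =
      realInner n (Complex.I • w) c := by
    intro c
    rw [realInner_I_left, ← hyperplane_smul, realInner_affineVec, realInner_I_left]
  rw [hopfForm_apply, realInner_affineVec_self, realInner_hyperplane, realInner_affineVec,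
    realInner_affineVec, hI, hI]
  simp only [fubiniStudyForm, sub_apply, smul_apply, add_apply,
    ContinuousLinearMap.smulRight_apply, smul_eq_mul]

/-- The affine coordinates of a line, as a function of a vector spanning it. -/
def affineProj (j : Fin (n + 1)) (z : CSpace (n + 1)) : CSpace n :=
  WithLp.toLp 2 fun k => z (j.succAbove k) / z j

lemma contDiffAt_affineProj {j : Fin (n + 1)} {z : CSpace (n + 1)} (hz : z j ≠ 0) :
    ContDiffAt ℝ ∞ (affineProj j) z := by
  rw [contDiffAt_piLp]
  intro k
  have h : ∀ i, ContDiff ℝ ∞ fun x : CSpace (n + 1) => x i := fun i =>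
    (contDiff_piLp 2).1 contDiff_id i
  simp only [affineProj, div_eq_mul_inv]
  exact (h _).contDiffAt.mul ((h j).contDiffAt.inv hz)

lemma affineVec_affineProj {j : Fin (n + 1)} {z : CSpace (n + 1)} (hz : z j ≠ 0) :
    affineVec j (affineProj j z) = (z j)⁻¹ • z := by
  ext i
  induction i using Fin.succAboveCases j with
  | x => simp [hz]
  | p k => simp [affineProj, div_eq_inv_mul]

lemma fderiv_affineProj_apply {j : Fin (n + 1)} {z : CSpace (n + 1)} (hz : z j ≠ 0)
    (u : CSpace (n + 1)) (k : Fin n) :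
    fderiv ℝ (affineProj j) z u k =
      (z j)⁻¹ * (u (j.succAbove k) - u j / z j * z (j.succAbove k)) := by
  have hd := ((contDiffAt_affineProj hz).differentiableAt (by simp)).hasFDerivAt
  have hx : ∀ i, HasFDerivAt (fun x : CSpace (n + 1) => x i)
      (PiLp.proj (𝕜 := ℝ) 2 (fun _ : Fin (n + 1) => ℂ) i) z := fun i =>
    (PiLp.proj (𝕜 := ℝ) 2 (fun _ : Fin (n + 1) => ℂ) i).hasFDerivAt
  have hk : HasFDerivAt (fun x => affineProj j x k)
      ((PiLp.proj (𝕜 := ℝ) 2 (fun _ : Fin n => ℂ) k).comp (fderiv ℝ (affineProj j) z)) z :=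
    (PiLp.proj (𝕜 := ℝ) 2 (fun _ : Fin n => ℂ) k).hasFDerivAt.comp z hd
  -- The quotient is differentiated implicitly, through the identity that the `k`-th affine
  -- coordinate times `x j` is the corresponding homogeneous coordinate.
  have hev : (fun x : CSpace (n + 1) => affineProj j x k * x j) =ᶠ[𝓝 z]
      fun x => x (j.succAbove k) := by
    have h1 : ContinuousAt (fun x : CSpace (n + 1) => x j) z := (hx j).continuousAt
    filter_upwards [h1.eventually_ne hz] with x hx
    exact div_mul_cancel₀ _ hx
  have h2 := congrArg (fun A => A u)
    (((hk.mul (hx j)).congr_of_eventuallyEq hev.symm).unique (hx (j.succAbove k)))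
  simp only [add_apply, smul_apply, ContinuousLinearMap.comp_apply, PiLp.proj_apply,
    smul_eq_mul] at h2
  have h3 : affineProj j z k = z (j.succAbove k) / z j := rfl
  rw [h3] at h2
  field_simp at h2 ⊢
  linear_combination h2

/-- Up to the factor `(z j)⁻¹` and a vertical vector, the differential of the affine coordinates is
the identity; the two invariances of `hopfForm` remove precisely these two discrepancies. -/
lemma hyperplane_fderiv_affineProj {j : Fin (n + 1)} {z : CSpace (n + 1)} (hz : z j ≠ 0)
    (u : CSpace (n + 1)) :
    hyperplane j (fderiv ℝ (affineProj j) z u) = (z j)⁻¹ • (u + (-(u j / z j)) • z) := by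
  ext i
  induction i using Fin.succAboveCases j with
  | x => simp [hz]
  | p k =>
    simp [fderiv_affineProj_apply hz]
    ring

lemma fderiv_affineProj_hyperplane {j : Fin (n + 1)} {z : CSpace (n + 1)} (hz : z j ≠ 0)
    (a : CSpace n) : fderiv ℝ (affineProj j) z (z j • hyperplane j a) = a := by
  ext k
  simp [fderiv_affineProj_apply hz, hz]

lemma fderiv_affineProj_self {j : Fin (n + 1)} {z : CSpace (n + 1)} (hz : z j ≠ 0) :
    fderiv ℝ (affineProj j) z z = 0 := by
  ext k
  simp [fderiv_affineProj_apply hz, hz]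

lemma fderiv_affineProj_I {j : Fin (n + 1)} {z : CSpace (n + 1)} (hz : z j ≠ 0)
    (u : CSpace (n + 1)) :
    fderiv ℝ (affineProj j) z (Complex.I • u) = Complex.I • fderiv ℝ (affineProj j) z u := by
  ext k
  simp [fderiv_affineProj_apply hz]
  ring

/-- `hopfForm` is the pull-back of the Fubini-Study metric. -/
lemma fubiniStudyForm_affineProj {j : Fin (n + 1)} {z : CSpace (n + 1)} (hz : z j ≠ 0)
    (u v : CSpace (n + 1)) :
    fubiniStudyForm (affineProj j z) (fderiv ℝ (affineProj j) z u) (fderiv ℝ (affineProj j) z v) =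
      hopfForm z u v := by
  rw [fubiniStudyForm_eq_hopfForm j, affineVec_affineProj hz, hyperplane_fderiv_affineProj hz,
    hyperplane_fderiv_affineProj hz, hopfForm_smul (inv_ne_zero hz), hopfForm_add_smul,
    hopfForm_symm, hopfForm_add_smul, hopfForm_symm]

lemma fderiv_affineVec (j : Fin (n + 1)) (w a : CSpace n) :
    fderiv ℝ (affineVec j) w a = hyperplane j a := by
  have hd := ((contDiff_affineVec j).differentiable (by simp) w).hasFDerivAt
  ext i
  have hi : HasFDerivAt (fun x => affineVec j x i)
      ((PiLp.proj (𝕜 := ℝ) 2 (fun _ : Fin (n + 1) => ℂ) i).comp (fderiv ℝ (affineVec j) w)) w :=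
    (PiLp.proj (𝕜 := ℝ) 2 (fun _ : Fin (n + 1) => ℂ) i).hasFDerivAt.comp w hd
  induction i using Fin.succAboveCases j with
  | x =>
    simp only [affineVec_same] at hi
    have h0 := congrArg (fun A => A a) (hi.unique (hasFDerivAt_const 1 w))
    simpa using h0
  | p k =>
    simp only [affineVec_succAbove] at hi
    refine (congrArg (fun A => A a) (hi.unique
      (PiLp.proj (𝕜 := ℝ) 2 (fun _ : Fin n => ℂ) k).hasFDerivAt)).trans ?_
    simp

/-- The invariance of the Fubini-Study metric under changes of affine coordinates. -/
lemma fubiniStudyForm_transition {i j : Fin (n + 1)} {w : CSpace n} (h : affineVec j w i ≠ 0)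
    (a b : CSpace n) :
    fubiniStudyForm (affineProj i (affineVec j w))
      (fderiv ℝ (fun x => affineProj i (affineVec j x)) w a)
      (fderiv ℝ (fun x => affineProj i (affineVec j x)) w b) = fubiniStudyForm w a b := by
  have hc : ∀ a, fderiv ℝ (fun x => affineProj i (affineVec j x)) w a =
      fderiv ℝ (affineProj i) (affineVec j w) (hyperplane j a) := by
    intro a
    have h1 := fderiv_comp w (g := affineProj i) ((contDiffAt_affineProj h).differentiableAt (by simp))
      ((contDiff_affineVec j).differentiable (by simp) w)
    have h2 := congrArg (fun A => A a) h1
    rw [← fderiv_affineVec j w a]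
    exact h2
  rw [hc, hc, fubiniStudyForm_affineProj h, fubiniStudyForm_eq_hopfForm j]

lemma fubiniStudyForm_symm (w a b : CSpace n) : fubiniStudyForm w a b = fubiniStudyForm w b a := by
  rw [fubiniStudyForm_eq_hopfForm 0, hopfForm_symm, ← fubiniStudyForm_eq_hopfForm]

/-- A null vector satisfies `(1 + |w|²)|a|² = |⟨w, a⟩|²` with the Hermitian product on the right,
and Cauchy-Schwarz leaves `|a|² ≤ 0`. -/
lemma fubiniStudyForm_nondegenerate (w a : CSpace n) (h : fubiniStudyForm w a = 0) : a = 0 := by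
  have h1 : fubiniStudyForm w a a = 0 := congrArg (fun A => A a) h
  simp only [fubiniStudyForm, sub_apply, smul_apply, add_apply,
    ContinuousLinearMap.smulRight_apply, smul_eq_mul, realInner_self] at h1
  have h2 : realInner n w a ^ 2 + realInner n (Complex.I • w) a ^ 2 ≤ (‖w‖ * ‖a‖) ^ 2 := by
    have h3 : ‖inner ℂ w a‖ ^ 2 = realInner n w a ^ 2 + realInner n (Complex.I • w) a ^ 2 := by
      rw [inner_eq_realInner, ← Complex.normSq_eq_norm_sq, Complex.normSq_add_mul_I]
    rw [← h3]
    exact pow_le_pow_left₀ (norm_nonneg _) (norm_inner_le_norm w a) 2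
  have hpos : (1 + ‖w‖ ^ 2 : ℝ) ≠ 0 := by positivity
  field_simp at h1
  have h4 : ‖a‖ ^ 2 ≤ 0 := by nlinarith
  exact norm_eq_zero.1 (pow_eq_zero_iff two_ne_zero |>.1 (le_antisymm h4 (sq_nonneg _)))

lemma differentiableAt_fubiniStudyForm (w : CSpace n) :
    DifferentiableAt ℝ (fubiniStudyForm (n := n)) w := by
  have h : fubiniStudyForm (n := n) = pullbackForm (affineVec 0) hopfForm := by
    funext w
    ext a b
    rw [pullbackForm_apply, fderiv_affineVec, fderiv_affineVec,
      fubiniStudyForm_eq_hopfForm 0]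
  rw [h]
  exact differentiableAt_pullbackForm ((contDiff_affineVec 0).contDiffAt.of_le two_le_infty)
    (differentiableAt_hopfForm (affineVec_ne_zero 0 w))

end CProj

/-! ### Affine charts and the Hopf map -/

namespace CProj

variable {n : ℕ}

instance isManifold_one : IsManifold 𝓘(ℝ, CSpace n) 1 (CProj n) :=
  IsManifold.of_le (n := ∞) (by simp)

lemma exists_chartAt_eq (q : CProj n) :
    ∃ j, chartAt (CSpace n) q = affineChart j ∧ q ∈ affineSource j :=
  ⟨_, rfl, (exists_mem_affineSource q).choose_spec⟩

lemma exists_chartAt_hopf_eq (z : OddSphere n) :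
    ∃ j, chartAt (CSpace n) (hopf z) = affineChart j ∧ (z : CSpace (n + 1)) j ≠ 0 := by
  obtain ⟨j, hj, h⟩ := exists_chartAt_eq (hopf z)
  exact ⟨j, hj, (mk_mem_affineSource j _ _).1 h⟩

lemma affineChart_hopf (j : Fin (n + 1)) (z : OddSphere n) :
    affineChart j (hopf z) = affineProj j (z : CSpace (n + 1)) :=
  affineCoord_mk j _ _

/-- `fubiniStudy` is defined at each point in the affine chart preferred there, and this choice
varies with the point. Invariance under transition maps shows that one formula holds throughout each
affine chart. -/
lemma chartMetric_fubiniStudy (q : CProj n) :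
    chartMetric (fubiniStudy n) q = fubiniStudyForm := by
  obtain ⟨j, hj, -⟩ := exists_chartAt_eq q
  funext w
  have hw : w ∈ (chartAt (CSpace n) q).target := by rw [hj]; trivial
  obtain ⟨i, hi, hs⟩ := exists_chartAt_eq ((chartAt (CSpace n) q).symm w)
  have hsymm : ∀ x, (chartAt (CSpace n) q).symm x =
      Projectivization.mk ℂ (affineVec j x) (affineVec_ne_zero j x) := fun x => by rw [hj]; rfl
  have hne : affineVec j w i ≠ 0 := by
    rw [hsymm] at hs
    exact (mk_mem_affineSource i _ _).1 hs
  have hcoord : ∀ x, chartAt (CSpace n) ((chartAt (CSpace n) q).symm w)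
      ((chartAt (CSpace n) q).symm x) = affineProj i (affineVec j x) := by
    intro x
    rw [hi, hsymm]
    exact affineCoord_mk i _ _
  ext a b
  rw [chartMetric_apply, chartSymmDeriv_eq hw, funext hcoord]
  refine Eq.trans ?_ (fubiniStudyForm_transition hne a b)
  rw [← hcoord w]
  rfl

lemma contMDiff_hopf :
    ContMDiff 𝓘(ℝ, RSpace (2 * n + 1)) 𝓘(ℝ, CSpace n) ∞ (hopf (n := n)) := by
  intro z
  obtain ⟨j, hj, hz⟩ := exists_chartAt_hopf_eq z
  have hcont : Continuous (hopf (n := n)) :=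
    isQuotientMap_proj.continuous.comp
      (continuous_subtype_val.subtype_mk fun z => ne_zero_of_mem_unit_sphere z)
  rw [contMDiffAt_iff_target]
  refine ⟨hcont.continuousAt, ?_⟩
  have h : (extChartAt 𝓘(ℝ, CSpace n) (hopf z)) ∘ hopf =
      affineProj j ∘ ((↑) : OddSphere n → CSpace (n + 1)) := by
    funext x
    simp only [mfld_simps, hj, Function.comp_apply]
    exact affineChart_hopf j x
  rw [h]
  exact (contDiffAt_affineProj hz).contMDiffAt.comp z (contMDiff_oddSphere_coe z)

/-- `hopfForm` is the Euclidean metric on horizontal vectors. -/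
lemma hopfForm_of_horizontal {z u : CSpace (n + 1)} (hz : ‖z‖ = 1)
    (hu : realInner (n + 1) u z = 0) (hu' : realInner (n + 1) u (Complex.I • z) = 0)
    (v : CSpace (n + 1)) : hopfForm z u v = realInner (n + 1) u v := by
  rw [hopfForm_apply, realInner_self, realInner_comm z u, hu, realInner_comm _ u, hu', hz]
  simp

/-- In affine coordinates, the covariant second derivative of the Hopf fibration vanishes on
horizontal vectors whose Hermitian product is real. -/
lemma fubiniStudyForm_add_christoffel {j : Fin (n + 1)} {z : CSpace (n + 1)} (hzj : z j ≠ 0)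
    (hz : ‖z‖ = 1) {a b : CSpace (n + 1)}
    (ha : realInner (n + 1) a z = 0) (ha' : realInner (n + 1) a (Complex.I • z) = 0)
    (hb : realInner (n + 1) b z = 0) (hb' : realInner (n + 1) b (Complex.I • z) = 0)
    (hab : realInner (n + 1) a (Complex.I • b) = 0) :
    fderiv ℝ (fderiv ℝ (affineProj j)) z a b +
      christoffel fubiniStudyForm (affineProj j z) (fderiv ℝ (affineProj j) z b)
        (fderiv ℝ (affineProj j) z a) = 0 := by
  refine fubiniStudyForm_nondegenerate (affineProj j z) _ ?_
  ext c
  -- The differential of `affineProj` is onto, so the test vector `c` lifts to a vector `d`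
  -- upstairs, where the transformation law for `hopfForm` applies.
  rw [← fderiv_affineProj_hyperplane hzj c]
  set d := z j • hyperplane j c
  have hev : pullbackForm (affineProj j) fubiniStudyForm =ᶠ[𝓝 z] hopfForm := by
    have h1 : ContinuousAt (fun x : CSpace (n + 1) => x j) z := by fun_prop
    filter_upwards [h1.eventually_ne hzj] with x hx
    ext u v
    exact fubiniStudyForm_affineProj hx u v
  have h := koszul_pullbackForm ((contDiffAt_affineProj hzj).of_le two_le_infty)
    (differentiableAt_fubiniStudyForm _) (fubiniStudyForm_symm _) a b d
  rw [hev.koszul_eq, koszul_hopfForm hz ha ha' hb hb' hab] at h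
  rw [map_add, add_apply, apply_christoffel (fubiniStudyForm_nondegenerate _), ← h]
  rfl

end CProj

/-! ### The Lagrangian immersion below a Legendrian one -/

section Hopf

variable {n : ℕ} {M : Type*} [TopologicalSpace M] [ChartedSpace (RSpace n) M]
variable {g : MetricField (RSpace n) M} {φ : M → OddSphere n}

open CProj

lemma chartExpr_hopf_comp {p : M} {j : Fin (n + 1)}
    (hj : chartAt (CSpace n) (hopf (φ p)) = affineChart j) :
    chartExpr (RSpace n) (CSpace n) (hopf ∘ φ) p = fun y => affineProj j (localLift φ p y) := by
  funext y
  simp only [chartExpr, Function.comp_apply, hj]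
  exact affineChart_hopf j _

namespace IsLegendrianImmersion

variable (hφ : IsLegendrianImmersion g φ)
include hφ

lemma contMDiff_hopf_comp : ContMDiff 𝓘(ℝ, RSpace n) 𝓘(ℝ, CSpace n) ∞ (hopf ∘ φ) :=
  contMDiff_hopf.comp hφ.contMDiff

variable [IsManifold 𝓘(ℝ, RSpace n) ∞ M]

lemma fderiv_affineProj_localLift {p : M} {j : Fin (n + 1)}
    (hz : (φ p : CSpace (n + 1)) j ≠ 0) (u : RSpace n) :
    fderiv ℝ (fun y => affineProj j (localLift φ p y)) (chartAt (RSpace n) p p) u =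
      fderiv ℝ (affineProj j) (φ p : CSpace (n + 1)) (coordDeriv φ p u) := by
  have h := fderiv_comp (chartAt (RSpace n) p p) (g := affineProj j) (f := localLift φ p)
    (by rw [localLift_self]; exact (contDiffAt_affineProj hz).differentiableAt (by simp))
    ((hφ.contDiffAt_localLift (mem_chart_target _ p)).differentiableAt (by simp))
  rw [localLift_self] at h
  exact congrArg (fun A => A u) h

lemma mfderiv_hopf_comp {p : M} {j : Fin (n + 1)}
    (hj : chartAt (CSpace n) (hopf (φ p)) = affineChart j) (hz : (φ p : CSpace (n + 1)) j ≠ 0)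
    (u : RSpace n) :
    (mfderiv 𝓘(ℝ, RSpace n) 𝓘(ℝ, CSpace n) (hopf ∘ φ) p u : CSpace n) =
      fderiv ℝ (affineProj j) (φ p : CSpace (n + 1)) (coordDeriv φ p u) := by
  rw [← hφ.fderiv_affineProj_localLift hz, ← chartExpr_hopf_comp hj]
  rw [(hφ.contMDiff_hopf_comp.mdifferentiable (by simp) p).mfderiv]
  simp only [writtenInExtChartAt, mfld_simps, fderivWithin_univ]
  rfl

/-- By the composition formula, the difference of the two sides is the covariant second derivative
of the projection on `df(u), df(v)`. These are horizontal with real Hermitian product, so it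
vanishes; the position term `g(u, v) φ` is vertical and projects to zero. -/
lemma secondFundamentalForm_hopf_comp {p : M} {j : Fin (n + 1)}
    (hj : chartAt (CSpace n) (hopf (φ p)) = affineChart j) (hz : (φ p : CSpace (n + 1)) j ≠ 0)
    (u v : RSpace n) :
    (secondFundamentalForm g (fubiniStudy n) (hopf ∘ φ) p u v : CSpace n) =
      fderiv ℝ (affineProj j) (φ p : CSpace (n + 1))
        (sphereIncl (φ p) (secondFundamentalForm g (roundMetric n) φ p u v)) := by
  have hψ := chartExpr_hopf_comp (φ := φ) (p := p) hj
  have hpt : chartAt (CSpace n) ((hopf ∘ φ) p) ((hopf ∘ φ) p) =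
      affineProj j (φ p : CSpace (n + 1)) := by
    simp only [Function.comp_apply, hj]
    exact affineChart_hopf j _
  have h2 := fderiv_fderiv_comp (Q := affineProj j) (P := localLift φ p)
    (y := chartAt (RSpace n) p p)
    (by rw [localLift_self]; exact (contDiffAt_affineProj hz).of_le two_le_infty)
    ((hφ.contDiffAt_localLift (mem_chart_target _ p)).of_le two_le_infty) u v
  rw [localLift_self] at h2
  refine (secondFundamentalForm_eq g (fubiniStudy n) (hopf ∘ φ) p u v).trans ?_
  rw [hψ, hpt, chartMetric_fubiniStudy, hφ.fderiv_affineProj_localLift hz,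
    hφ.fderiv_affineProj_localLift hz, hφ.fderiv_affineProj_localLift hz, h2,
    hφ.sphereIncl_secondFundamentalForm, map_add, map_sub, map_smul, fderiv_affineProj_self hz]
  have h3 := fubiniStudyForm_add_christoffel hz (by simp) (hφ.realInner_coordDeriv_self p u)
    (hφ.realInner_coordDeriv_I_self p u) (hφ.realInner_coordDeriv_self p v)
    (hφ.realInner_coordDeriv_I_self p v) (hφ.realInner_coordDeriv_I p u v)
  have key : ∀ (a b c d : CSpace n) (t : ℝ), a + d = 0 →
      a + b + d - c = b - c + t • (0 : CSpace n) := by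
    intro a b c d t h
    rw [smul_zero, add_zero, add_right_comm, h, zero_add]
  exact key _ _ _ _ _ h3

lemma meanCurvature_hopf_comp {p : M} {j : Fin (n + 1)}
    (hj : chartAt (CSpace n) (hopf (φ p)) = affineChart j) (hz : (φ p : CSpace (n + 1)) j ≠ 0) :
    (meanCurvature g (fubiniStudy n) (hopf ∘ φ) p : CSpace n) =
      fderiv ℝ (affineProj j) (φ p : CSpace (n + 1)) (meanVec g φ p) := by
  have h1 : meanVec g φ p = (1 / finrank ℝ (RSpace n) : ℝ) • ∑ i, sphereIncl (φ p)
      (secondFundamentalForm g (roundMetric n) φ p (finBasis ℝ (RSpace n) i) (dualVec g p i)) := by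
    rw [← map_sum, ← map_smul]
    rfl
  have h2 : (meanCurvature g (fubiniStudy n) (hopf ∘ φ) p : CSpace n) =
      (1 / finrank ℝ (RSpace n) : ℝ) • ∑ i, (secondFundamentalForm g (fubiniStudy n) (hopf ∘ φ) p
        (finBasis ℝ (RSpace n) i) (dualVec g p i) : CSpace n) := rfl
  rw [h1, h2, map_smul, map_sum]
  congr 1
  exact Finset.sum_congr rfl fun i _ => hφ.secondFundamentalForm_hopf_comp hj hz _ _

lemma fubiniStudy_mfderiv_hopf_comp (p : M) (u v : RSpace n) :
    fubiniStudy n ((hopf ∘ φ) p) (mfderiv 𝓘(ℝ, RSpace n) 𝓘(ℝ, CSpace n) (hopf ∘ φ) p u)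
      (mfderiv 𝓘(ℝ, RSpace n) 𝓘(ℝ, CSpace n) (hopf ∘ φ) p v) = coordMetric g p u v := by
  obtain ⟨j, hj, hz⟩ := exists_chartAt_hopf_eq (φ p)
  rw [hφ.coordMetric_apply, ← hopfForm_of_horizontal (z := (φ p : CSpace (n + 1))) (by simp)
    (hφ.realInner_coordDeriv_self p u) (hφ.realInner_coordDeriv_I_self p u),
    ← fubiniStudyForm_affineProj hz, ← hφ.mfderiv_hopf_comp hj hz, ← hφ.mfderiv_hopf_comp hj hz,
    ← affineChart_hopf, ← hj]
  rfl

lemma mfderiv_hopf_comp_injective (p : M) :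
    Function.Injective (mfderiv 𝓘(ℝ, RSpace n) 𝓘(ℝ, CSpace n) (hopf ∘ φ) p) := by
  refine (injective_iff_map_eq_zero _).2 fun u hu => hφ.metric_nondegenerate p u ?_
  ext v
  have h := hφ.fubiniStudy_mfderiv_hopf_comp p u v
  refine h.symm.trans ?_
  refine (congrArg (fun a => fubiniStudy n ((hopf ∘ φ) p) a _) hu).trans ?_
  simp

theorem isLagrangianImmersion_hopf_comp : IsLagrangianImmersion g (hopf ∘ φ) where
  contMDiff := hφ.contMDiff_hopf_comp
  injective := hφ.mfderiv_hopf_comp_injective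
  isometric := hφ.fubiniStudy_mfderiv_hopf_comp
  lagrangian p u v := by
    obtain ⟨j, hj, hz⟩ := exists_chartAt_hopf_eq (φ p)
    have hu := hφ.mfderiv_hopf_comp hj hz u
    have hv := hφ.mfderiv_hopf_comp hj hz v
    have hpt : chartAt (CSpace n) (hopf (φ p)) (hopf (φ p)) =
        affineProj j (φ p : CSpace (n + 1)) := by rw [hj]; exact affineChart_hopf j _
    have h : ∀ a b : CSpace n,
        a = fderiv ℝ (affineProj j) (φ p : CSpace (n + 1)) (coordDeriv φ p u) →
        b = fderiv ℝ (affineProj j) (φ p : CSpace (n + 1)) (coordDeriv φ p v) →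
        fubiniStudyForm (chartAt (CSpace n) (hopf (φ p)) (hopf (φ p))) (Complex.I • a) b = 0 := by
      rintro _ _ rfl rfl
      rw [hpt, ← fderiv_affineProj_I hz, fubiniStudyForm_affineProj hz, hopfForm_symm,
        hopfForm_of_horizontal (by simp) (hφ.realInner_coordDeriv_self p v)
        (hφ.realInner_coordDeriv_I_self p v)]
      exact hφ.realInner_coordDeriv_I p v u
    exact h _ _ hu hv

/-- The projection carries `H` to `H_Φ` and commutes with `J`, so the field representing `JH` also
represents `JH_Φ`; injectivity of the differential of `Φ` makes it the only one. -/
theorem isCMinimal_iff_isHMinimal : IsCMinimal g φ ↔ IsHMinimal g (hopf ∘ φ) := by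
  obtain ⟨X, hX⟩ := hφ.exists_field
  have hΦ : ∀ p, mfderiv 𝓘(ℝ, RSpace n) 𝓘(ℝ, CSpace n) (hopf ∘ φ) p (X p) =
      complexStructure ((hopf ∘ φ) p) (meanCurvature g (fubiniStudy n) (hopf ∘ φ) p) := by
    intro p
    obtain ⟨j, hj, hz⟩ := exists_chartAt_hopf_eq (φ p)
    have hXp : coordDeriv φ p (X p) = Complex.I • meanVec g φ p := by
      rw [hφ.coordDeriv_eq]
      exact hX p
    refine (hφ.mfderiv_hopf_comp hj hz (X p)).trans ?_
    rw [hXp, fderiv_affineProj_I hz, ← hφ.meanCurvature_hopf_comp hj hz]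
    rfl
  rw [hφ.isCMinimal_iff hX]
  refine ⟨fun h => ⟨X, hΦ, h⟩, ?_⟩
  rintro ⟨Y, hY, h⟩
  have : X = Y := funext fun p =>
    hφ.mfderiv_hopf_comp_injective p ((hΦ p).trans (hY p).symm)
  rwa [this]

end IsLegendrianImmersion

end Hopf

end

theorem proposition2 {n : ℕ} {M : Type*} [TopologicalSpace M] [ChartedSpace (RSpace n) M]
    [IsManifold 𝓘(ℝ, RSpace n) ∞ M]
    (g : Bundle.ContMDiffRiemannianMetric 𝓘(ℝ, RSpace n) ∞ (RSpace n)
      (fun p : M => TangentSpace 𝓘(ℝ, RSpace n) p))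
    (φ : M → OddSphere n) (hφ : IsLegendrianImmersion g.inner φ) :
    (∀ o : ∀ p : M, Orientation ℝ (TangentSpace 𝓘(ℝ, RSpace n) p) (Fin n),
      IsManifoldOrientation o →
        ∃ β : M → Real.Angle, (∀ β', IsLegendrianAngle g.inner φ o β' ↔ β' = β) ∧
          (IsCMinimal g.inner φ ↔ IsHarmonicAngle g.inner β)) ∧
    IsLagrangianImmersion g.inner (CProj.hopf ∘ φ) ∧
    (IsCMinimal g.inner φ ↔ IsHMinimal g.inner (CProj.hopf ∘ φ)) := by
  refine ⟨fun o ho => ?_, hφ.isLagrangianImmersion_hopf_comp, hφ.isCMinimal_iff_isHMinimal⟩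
  obtain ⟨β, hβ⟩ := hφ.exists_isLegendrianAngle o
  refine ⟨β, fun β' => ⟨fun h => hφ.isLegendrianAngle_unique hβ h, ?_⟩,
    hφ.isCMinimal_iff_isHarmonicAngle ho hβ⟩
  rintro rfl
  exact hβ
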